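/- Let $\gamma:(\mathbf R,t_0)\to\mathbf{R}P^3$ be a $C^\infty$ curve-germ. It is of *finite type* if, in each system of affine coordinates near $\gamma(t_0)$, the $3\times\infty$ matrix $(\gamma'(t_0),\gamma''(t_0),\dots)$ has rank $3$; its *type* is then $(a_1,a_2,a_3)$ with $a_i=\min\{r \mid \operatorname{rank}(\gamma'(t_0),\dots,\gamma^{(r)}(t_0))=i\}$. For a curve-germ of finite type the tangent line is defined at every parameter near $t_0$ (by continuity where $\gamma'=0$) and varies smoothly. The *tangent developable* of $\gamma$ is the germ at $(t_0,\gamma(t_0))$ of the map $(t,p)\mapsto p$ on the surface of pairs consisting of a parameter $t$ and a point $p$ of the tangent line at $t$. The *dual surface* of $\gamma$ is the germ, at $t_0$ and the osculating plane at $t_0$ (the plane spanned by $\gamma(t_0)$ and the directions $\gamma'(t_0),\dots,\gamma^{(a_2)}(t_0)$), of the map $(t,\Pi)\mapsto\Pi\in\mathbf{R}P^{3*}$ on the surface of pairs consisting of a parameter $t$ and a plane $\Pi$ containing the tangent line at $t$. Two surface-germs are *diffeomorphic* if they are $C^\infty$ right-left equivalent as map-germs $(\mathbf R^2,0)\to(\mathbf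 R^3,0)$, after a choice of local coordinates. The *cuspidal edge* and the *swallowtail* are the germs at $0$ of $(x,t)\mapsto(x,\,3t^2-2xt,\,2t^3-xt^2)$ and $(x,t)\mapsto(x,\,4t^3-2xt,\,3t^4-xt^2)$. (1) Let $\gamma,\gamma'$ be $C^\infty$ curve-germs of finite type in $\mathbf{R}P^3$. If their tangent developables are diffeomorphic, then their types coincide. (2) Let $\gamma$ be a $C^\infty$ curve-germ of finite type in $\mathbf{R}P^3$. If its dual surface is diffeomorphic to the cuspidal edge (resp. the swallowtail), then $\gamma$ has type $(1,2,3)$ (resp. $(1,2,4)$). -/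

import Mathlib

open scoped ContDiff Topology LinearAlgebra.Projectivization

noncomputable section

namespace TangentDev

/-- Homogeneous coordinate vectors. -/
abbrev V4 : Type := Fin 4 → ℝ

/-- Affine three-space. -/
abbrev E3 : Type := Fin 3 → ℝ

/-- Real projective three-space. The dual projective space is written in the dual homogeneous
coordinates, so a point `[Y]` of it is the plane `{[X] | X ⬝ᵥ Y = 0}`. -/
abbrev RP3 : Type := ℙ ℝ V4

/-- `p` is the point with homogeneous coordinates `x` (in particular `x ≠ 0`). -/
def HasCoords (p : RP3) (x : V4) : Prop :=
  ∃ h : x ≠ 0, p = Projectivization.mk ℝ x h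

/-- `f` is `C^∞` on a neighbourhood of `x`. (For the order `∞`, `ContDiffAt` at the single point
`x` would be weaker.) -/
def SmoothNear {E F : Type} [NormedAddCommGroup E] [NormedSpace ℝ E]
    [NormedAddCommGroup F] [NormedSpace ℝ F] (f : E → F) (x : E) : Prop :=
  ∀ᶠ y in 𝓝 x, ContDiffAt ℝ ∞ f y

/-! ### Affine coordinates -/

/-- `p` lies in the domain of the system of affine coordinates given by the linear change `A` of
homogeneous coordinates, i.e. off the plane at infinity. -/
def InChart (A : V4 ≃ₗ[ℝ] V4) (p : RP3) : Prop := A p.rep 0 ≠ 0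

/-- The system of affine coordinates of `A`: `[X] ↦ (x₁/x₀, x₂/x₀, x₃/x₀)` with `x = A X`. -/
def affCoord (A : V4 ≃ₗ[ℝ] V4) (p : RP3) : E3 := fun i => A p.rep i.succ / A p.rep 0

/-! ### Curve-germs, finite type, type -/

/-- `X` is a `C^∞` homogeneous lift of the germ of `γ` at `t₀`. -/
def IsLift (γ : ℝ → RP3) (t₀ : ℝ) (X : ℝ → V4) : Prop :=
  SmoothNear X t₀ ∧ ∀ᶠ t in 𝓝 t₀, HasCoords (γ t) (X t)

/-- The germ of `γ` at `t₀` is a `C^∞` curve-germ in projective space. -/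
def SmoothCurveGerm (γ : ℝ → RP3) (t₀ : ℝ) : Prop := ∃ X, IsLift γ t₀ X

/-- The `3 × r` matrix `(c'(t), c''(t), …, c⁽ʳ⁾(t))`. -/
def derivMatrix (c : ℝ → E3) (t : ℝ) (r : ℕ) : Matrix (Fin 3) (Fin r) ℝ :=
  Matrix.of fun i j => iteratedDeriv ((j : ℕ) + 1) c t i

/-- `γ` is of finite type at `t₀`: in each system of affine coordinates near `γ t₀`, the
`3 × ∞` matrix of all derivatives has rank `3`. -/
def FiniteType (γ : ℝ → RP3) (t₀ : ℝ) : Prop :=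
  ∀ A : V4 ≃ₗ[ℝ] V4, InChart A (γ t₀) →
    Module.finrank ℝ (Submodule.span ℝ
      (Set.range fun k : ℕ => iteratedDeriv (k + 1) (affCoord A ∘ γ) t₀)) = 3

/-- `γ` has type `(a₁, a₂, a₃)` at `t₀`: in each system of affine coordinates near `γ t₀`,
`aᵢ` is the least `r` such that the `3 × r` matrix of derivatives has rank `i`. -/
def HasType (γ : ℝ → RP3) (t₀ : ℝ) (a₁ a₂ a₃ : ℕ) : Prop :=
  ∀ A : V4 ≃ₗ[ℝ] V4, InChart A (γ t₀) →
    IsLeast {r | (derivMatrix (affCoord A ∘ γ) t₀ r).rank = 1} a₁ ∧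
    IsLeast {r | (derivMatrix (affCoord A ∘ γ) t₀ r).rank = 2} a₂ ∧
    IsLeast {r | (derivMatrix (affCoord A ∘ γ) t₀ r).rank = 3} a₃

/-! ### Tangent developables and dual surfaces -/

/-- `X` is a lift of `γ`, and for `t` near `t₀` the tangent line to `γ` at `t` is the projective
line of the plane spanned by `X t` and `W t`, which vary smoothly. At parameters where `γ` is
immersed this line is spanned by `X t` and `X' t`; for a curve of finite type these parameters are
dense near `t₀`, so the line at every parameter near `t₀` is determined by continuity. -/
def TangentFrame (γ : ℝ → RP3) (t₀ : ℝ) (X W : ℝ → V4) : Prop :=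
  IsLift γ t₀ X ∧ SmoothNear W t₀ ∧
    ∀ᶠ t in 𝓝 t₀, LinearIndependent ℝ ![X t, W t] ∧
      deriv X t ∈ Submodule.span ℝ {X t, W t}

/-- The germ of `F` at `(t₀, 0)` parametrises the tangent developable of the germ of `γ` at `t₀`,
the surface ruled by the tangent lines: `F (t, u)` runs over the tangent line at `t`, and
`F (t, 0) = γ t`. -/
def IsTangentDevelopable (γ : ℝ → RP3) (t₀ : ℝ) (F : ℝ × ℝ → RP3) : Prop :=
  ∃ X W : ℝ → V4, TangentFrame γ t₀ X W ∧
    ∀ᶠ z in 𝓝 (t₀, (0 : ℝ)), HasCoords (F z) (X z.1 + z.2 • W z.1)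

/-- The plane `[y]` is the osculating plane at `t₀` of the curve with lift `X`: the plane spanned
by `X t₀, X' t₀, …, X⁽ᵏ⁾ t₀` where these derivatives span a three-dimensional space. -/
def IsOsculatingPlane (X : ℝ → V4) (t₀ : ℝ) (y : V4) : Prop :=
  y ≠ 0 ∧ ∃ k : ℕ,
    Module.finrank ℝ (Submodule.span ℝ
      (Set.range fun j : Fin (k + 1) => iteratedDeriv (j : ℕ) X t₀)) = 3 ∧
    ∀ j ≤ k, iteratedDeriv j X t₀ ⬝ᵥ y = 0

/-- The germ of `F` at `(t₀, 0)` parametrises the dual surface of the germ of `γ` at `t₀`: the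
projection to the dual space of the conormal bundle of `γ`, i.e. of the set of pairs of a
parameter `t` and a plane that contains the tangent line at `t`. The planes at `t` form the pencil
`[Y t + u • Z t]`, and the base point is the osculating plane at `t₀`. -/
def IsDualSurface (γ : ℝ → RP3) (t₀ : ℝ) (F : ℝ × ℝ → RP3) : Prop :=
  ∃ X W Y Z : ℝ → V4, TangentFrame γ t₀ X W ∧ SmoothNear Y t₀ ∧ SmoothNear Z t₀ ∧
    (∀ᶠ t in 𝓝 t₀, LinearIndependent ℝ ![Y t, Z t] ∧
      X t ⬝ᵥ Y t = 0 ∧ W t ⬝ᵥ Y t = 0 ∧ X t ⬝ᵥ Z t = 0 ∧ W t ⬝ᵥ Z t = 0) ∧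
    IsOsculatingPlane X t₀ (Y t₀) ∧
    ∀ᶠ z in 𝓝 (t₀, (0 : ℝ)), HasCoords (F z) (Y z.1 + z.2 • Z z.1)

/-! ### Diffeomorphism of surface-germs (right-left equivalence) -/

/-- `φ` is a `C^∞` diffeomorphism between open sets. -/
def IsDiffeo {E : Type} [NormedAddCommGroup E] [NormedSpace ℝ E]
    (φ : OpenPartialHomeomorph E E) : Prop :=
  ContDiffOn ℝ ∞ φ φ.source ∧ ContDiffOn ℝ ∞ φ.symm φ.target

/-- The map-germs of `f` at `q` and of `g` at `q'` are `C^∞` right-left equivalent: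
`τ ∘ f = g ∘ σ` near `q` for diffeomorphism-germs `σ : (ℝ², q) → (ℝ², q')` and
`τ : (ℝ³, f q) → (ℝ³, g q')`. -/
def RightLeftEquiv (f : ℝ × ℝ → E3) (q : ℝ × ℝ) (g : ℝ × ℝ → E3) (q' : ℝ × ℝ) : Prop :=
  ∃ (σ : OpenPartialHomeomorph (ℝ × ℝ) (ℝ × ℝ)) (τ : OpenPartialHomeomorph E3 E3),
    IsDiffeo σ ∧ IsDiffeo τ ∧ q ∈ σ.source ∧ σ q = q' ∧ f q ∈ τ.source ∧
    ∀ᶠ z in 𝓝 q, τ (f z) = g (σ z)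

/-- Right-left equivalence of surface-germs in projective space, read in affine coordinates. -/
def DiffeoGerms (F : ℝ × ℝ → RP3) (q : ℝ × ℝ) (G : ℝ × ℝ → RP3) (q' : ℝ × ℝ) : Prop :=
  ∃ A B : V4 ≃ₗ[ℝ] V4, InChart A (F q) ∧ InChart B (G q') ∧
    RightLeftEquiv (affCoord A ∘ F) q (affCoord B ∘ G) q'

/-- The model cuspidal edge, in the parameters `z = (x, t)`. -/
def cuspidalEdge (z : ℝ × ℝ) : E3 :=
  ![z.1, 3 * z.2 ^ 2 - 2 * z.1 * z.2, 2 * z.2 ^ 3 - z.1 * z.2 ^ 2]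

/-- The model swallowtail, in the parameters `z = (x, t)`. -/
def swallowtail (z : ℝ × ℝ) : E3 :=
  ![z.1, 4 * z.2 ^ 3 - 2 * z.1 * z.2, 3 * z.2 ^ 4 - z.1 * z.2 ^ 2]

/-- The surface-germ of `F` at `q` in projective space is diffeomorphic to the germ at the origin
of `g`. -/
def DiffeoToModel (F : ℝ × ℝ → RP3) (q : ℝ × ℝ) (g : ℝ × ℝ → E3) : Prop :=
  ∃ A : V4 ≃ₗ[ℝ] V4, InChart A (F q) ∧ RightLeftEquiv (affCoord A ∘ F) q g (0, 0)

end TangentDev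

end

/-!
In suitable affine coordinates a curve of finite type is `c` with `c' = c₁' • (1, h₂, h₃)` and
`(h₂, h₃)' = h₂' • (1, k)`, all functions being smooth at `t₀`; its type is
`(a + 1, a + b + 2, a + b + d + 3)`, where `a`, `b`, `d` are the orders of vanishing of `c₁'`, `h₂'`
and `k'`. Every parametrisation of its tangent lines is right-left equivalent to
`S (t, u) = c t + u • (1, h₂ t, h₃ t)`, and the differential of `S` sends `(1, -c₁')` to
`u h₂' • (0, 1, k)`. The osculating planes are limits of tangent planes of `S`, so a right-left
equivalence between two such surfaces respects them. Comparing coefficients of its differential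
then recovers `b` from `u h₂'` along the diagonal `u = t - t₀`, and `a`, `d` from `c₁'`, `k'` along
the curve. The one obstruction is that the image of the curve may be tangent to the ruling of the
other surface, but then `a = 0` for the first curve and `d = 0` for both, and the inverse
equivalence gives the rest.

By projective duality the dual surface is the tangent developable of the curve of osculating planes.
That curve has orders `(d, b, a)`, and the cuspidal edge and the swallowtail are the tangent
developables of curves with orders `(0, 0, 0)` and `(1, 0, 0)`.
-/

noncomputable section

namespace TangentDev

open Filter Asymptotics

/-! ### Smoothness near a point -/

section Smooth

variable {E F G : Type} [NormedAddCommGroup E] [NormedSpace ℝ E] [NormedAddCommGroup F]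
  [NormedSpace ℝ F] [NormedAddCommGroup G] [NormedSpace ℝ G]

theorem smoothNear_of_contDiff {f : E → F} (h : ContDiff ℝ ∞ f) (x : E) : SmoothNear f x :=
  Eventually.of_forall fun _ => h.contDiffAt

theorem smoothNear_const (c : F) (x : E) : SmoothNear (fun _ : E => c) x :=
  smoothNear_of_contDiff contDiff_const x

namespace SmoothNear

theorem contDiffAt {f : E → F} {x : E} (h : SmoothNear f x) : ContDiffAt ℝ ∞ f x :=
  h.self_of_nhds

theorem continuousAt {f : E → F} {x : E} (h : SmoothNear f x) : ContinuousAt f x :=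
  h.contDiffAt.continuousAt

theorem differentiableAt {f : E → F} {x : E} (h : SmoothNear f x) : DifferentiableAt ℝ f x :=
  h.contDiffAt.differentiableAt (by simp)

theorem eventually {f : E → F} {x : E} (h : SmoothNear f x) : ∀ᶠ y in 𝓝 x, SmoothNear f y :=
  eventually_eventually_nhds.2 h

theorem congr {f g : E → F} {x : E} (h : SmoothNear f x) (hfg : g =ᶠ[𝓝 x] f) :
    SmoothNear g x := by
  filter_upwards [h, eventually_eventually_nhds.2 hfg] with y hy hfgy
    using hy.congr_of_eventuallyEq hfgy

theorem comp {g : F → G} {f : E → F} {x : E} (hg : SmoothNear g (f x)) (hf : SmoothNear f x) :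
    SmoothNear (fun y => g (f y)) x := by
  filter_upwards [hf, hf.continuousAt.eventually hg] with y hfy hgy using hgy.comp y hfy

theorem comp_fst {f : ℝ → F} {p : ℝ × ℝ} (hf : SmoothNear f p.1) :
    SmoothNear (fun z : ℝ × ℝ => f z.1) p :=
  comp (f := Prod.fst) hf (smoothNear_of_contDiff contDiff_fst p)

theorem fst {f : E → F × G} {x : E} (hf : SmoothNear f x) : SmoothNear (fun y => (f y).1) x :=
  comp (g := Prod.fst) (smoothNear_of_contDiff contDiff_fst _) hf

theorem snd {f : E → F × G} {x : E} (hf : SmoothNear f x) : SmoothNear (fun y => (f y).2) x :=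
  comp (g := Prod.snd) (smoothNear_of_contDiff contDiff_snd _) hf

theorem add {f g : E → F} {x : E} (hf : SmoothNear f x) (hg : SmoothNear g x) :
    SmoothNear (fun y => f y + g y) x := by
  filter_upwards [hf, hg] with y hfy hgy using hfy.add hgy

theorem sub {f g : E → F} {x : E} (hf : SmoothNear f x) (hg : SmoothNear g x) :
    SmoothNear (fun y => f y - g y) x := by
  filter_upwards [hf, hg] with y hfy hgy using hfy.sub hgy

theorem neg {f : E → F} {x : E} (hf : SmoothNear f x) : SmoothNear (fun y => -f y) x := by
  filter_upwards [hf] with y hfy using hfy.neg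

theorem smul {f : E → ℝ} {g : E → F} {x : E} (hf : SmoothNear f x) (hg : SmoothNear g x) :
    SmoothNear (fun y => f y • g y) x := by
  filter_upwards [hf, hg] with y hfy hgy using hfy.smul hgy

theorem mul {f g : E → ℝ} {x : E} (hf : SmoothNear f x) (hg : SmoothNear g x) :
    SmoothNear (fun y => f y * g y) x :=
  hf.smul hg

theorem div {f g : E → ℝ} {x : E} (hf : SmoothNear f x) (hg : SmoothNear g x) (h0 : g x ≠ 0) :
    SmoothNear (fun y => f y / g y) x := by
  filter_upwards [hf, hg, hg.continuousAt.eventually_ne h0] with y hfy hgy h using hfy.div hgy h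

theorem prodMk {f : E → F} {g : E → G} {x : E} (hf : SmoothNear f x) (hg : SmoothNear g x) :
    SmoothNear (fun y => (f y, g y)) x := by
  filter_upwards [hf, hg] with y hfy hgy using hfy.prodMk hgy

theorem pi {ι : Type} [Fintype ι] {f : E → ι → ℝ} {x : E}
    (h : ∀ i, SmoothNear (fun y => f y i) x) : SmoothNear f x := by
  filter_upwards [eventually_all.2 h] with y hy using contDiffAt_pi.2 hy

theorem apply {ι : Type} [Fintype ι] {f : E → ι → ℝ} {x : E} (h : SmoothNear f x) (i : ι) :
    SmoothNear (fun y => f y i) x := by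
  filter_upwards [h] with y hy using contDiffAt_pi.1 hy i

theorem linearMap_comp [FiniteDimensional ℝ F] {f : E → F} {x : E} (h : SmoothNear f x)
    (L : F →ₗ[ℝ] G) : SmoothNear (fun y => L (f y)) x :=
  comp (g := L) (smoothNear_of_contDiff L.toContinuousLinearMap.contDiff _) h

theorem clm_apply {T : E → F →L[ℝ] G} {f : E → F} {x : E} (hT : SmoothNear T x)
    (hf : SmoothNear f x) : SmoothNear (fun y => T y (f y)) x := by
  filter_upwards [hT, hf] with y hTy hfy using hTy.clm_apply hfy

theorem fderiv {f : E → F} {x : E} (h : SmoothNear f x) :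
    SmoothNear (fun y => fderiv ℝ f y) x := by
  filter_upwards [h] with y hy using hy.fderiv_right (by simp)

theorem deriv {f : ℝ → F} {x : ℝ} (h : SmoothNear f x) : SmoothNear (deriv f) x :=
  (h.fderiv.clm_apply (smoothNear_const (1 : ℝ) x)).congr (.of_forall fun y => by simp)

theorem iteratedDeriv {f : ℝ → F} {x : ℝ} (h : SmoothNear f x) (n : ℕ) :
    SmoothNear (iteratedDeriv n f) x := by
  induction n with
  | zero => simpa using h
  | succ n ih => rw [iteratedDeriv_succ]; exact ih.deriv

theorem exists_contDiff {f : ℝ → F} {t₀ : ℝ} (hf : SmoothNear f t₀) :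
    ∃ g : ℝ → F, ContDiff ℝ ∞ g ∧ f =ᶠ[𝓝 t₀] g := by
  obtain ⟨r, hr, hball⟩ := Metric.eventually_nhds_iff_ball.1 hf
  let φ : ContDiffBump t₀ := ⟨r / 3, r / 2, by positivity, by linarith⟩
  refine ⟨fun t => φ t • f t, contDiff_iff_contDiffAt.2 fun t => ?_, ?_⟩
  · by_cases ht : t ∈ tsupport φ
    · rw [φ.tsupport_eq] at ht
      exact φ.contDiffAt.smul
        (hball t (Metric.closedBall_subset_ball (show r / 2 < r by linarith) ht))
    · refine (contDiffAt_const (c := (0 : F))).congr_of_eventuallyEq ?_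
      filter_upwards [(isClosed_tsupport φ).isOpen_compl.mem_nhds ht] with x hx
      rw [image_eq_zero_of_notMem_tsupport hx, zero_smul]
  · filter_upwards [φ.eventuallyEq_one] with t ht
    rw [ht, Pi.one_apply, one_smul]

end SmoothNear

theorem smoothNear_sub_pow (t₀ x : ℝ) (k : ℕ) : SmoothNear (fun t : ℝ => (t - t₀) ^ k) x :=
  smoothNear_of_contDiff ((contDiff_id.sub contDiff_const).pow k) x

end Smooth

/-! ### Smooth division -/

section Division

variable {F : Type*} [NormedAddCommGroup F] [NormedSpace ℝ F] {g : ℝ → F}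

theorem hasDerivAt_integral_pow_smul (hg : ContDiff ℝ 1 g) (t₀ : ℝ) (m : ℕ) (t : ℝ) :
    HasDerivAt (fun t => ∫ s in (0 : ℝ)..1, s ^ m • g (t₀ + s * (t - t₀)))
      (∫ s in (0 : ℝ)..1, s ^ (m + 1) • deriv g (t₀ + s * (t - t₀))) t := by
  have : Continuous (deriv g) := hg.continuous_deriv le_rfl
  have hgc : Continuous g := hg.continuous
  have hcont : Continuous fun p : ℝ × ℝ => p.2 ^ (m + 1) • deriv g (t₀ + p.2 * (p.1 - t₀)) := by
    fun_prop
  obtain ⟨C, hC⟩ := ((isCompact_closedBall t 1).prod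
    (isCompact_Icc (a := (0 : ℝ)) (b := 1))).exists_bound_of_continuousOn hcont.continuousOn
  refine (intervalIntegral.hasDerivAt_integral_of_dominated_loc_of_deriv_le
    (μ := MeasureTheory.volume) (F := fun t s => s ^ m • g (t₀ + s * (t - t₀)))
    (F' := fun t s => s ^ (m + 1) • deriv g (t₀ + s * (t - t₀))) (bound := fun _ => C)
    (Metric.closedBall_mem_nhds t one_pos) (.of_forall fun x =>
      Continuous.aestronglyMeasurable (by fun_prop))
    (Continuous.intervalIntegrable (by fun_prop) _ _)
    (Continuous.aestronglyMeasurable (by fun_prop)) (.of_forall fun s hs x hx => ?_)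
    intervalIntegrable_const (.of_forall fun s _ x _ => ?_)).2
  · rw [Set.uIoc_of_le zero_le_one] at hs
    exact hC (x, s) ⟨hx, hs.1.le, hs.2⟩
  · have hline : HasDerivAt (fun t : ℝ => t₀ + s * (t - t₀)) s x := by
      simpa using (((hasDerivAt_id x).sub_const t₀).const_mul s).const_add t₀
    have hgx := ((hg.differentiable one_ne_zero) (t₀ + s * (x - t₀))).hasDerivAt
    refine ((hgx.scomp x hline).const_smul (s ^ m)).congr_deriv ?_
    rw [smul_smul, pow_succ]

theorem contDiff_integral_pow_smul (hg : ContDiff ℝ ∞ g) (t₀ : ℝ) (m : ℕ) :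
    ContDiff ℝ ∞ (fun t => ∫ s in (0 : ℝ)..1, s ^ m • g (t₀ + s * (t - t₀))) := by
  have hderiv {g : ℝ → F} (hg : ContDiff ℝ ∞ g) (m : ℕ) :=
    hasDerivAt_integral_pow_smul (hg.of_le (by simp)) t₀ m
  rw [contDiff_infty]
  intro n
  induction n generalizing g m with
  | zero =>
    have hdiff : Differentiable ℝ fun t => ∫ s in (0 : ℝ)..1, s ^ m • g (t₀ + s * (t - t₀)) :=
      fun t => (hderiv hg m t).differentiableAt
    exact contDiff_zero.2 hdiff.continuous
  | succ n ih =>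
    push_cast
    rw [contDiff_succ_iff_deriv, funext fun t => (hderiv hg m t).deriv]
    exact ⟨fun t => (hderiv hg m t).differentiableAt, by simp,
      ih (contDiff_infty_iff_deriv.1 hg).2 (m + 1)⟩

theorem integral_pow_smul_comp_affine (g : ℝ → F) (t₀ t : ℝ) (k : ℕ) :
    ∫ x in t₀..t, (x - t₀) ^ k • g x =
      (t - t₀) ^ (k + 1) • ∫ s in (0 : ℝ)..1, s ^ k • g (t₀ + s * (t - t₀)) := by
  have hsubst := intervalIntegral.smul_integral_comp_mul_add (a := 0) (b := 1)
    (fun x => (x - t₀) ^ k • g x) (t - t₀) t₀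
  simp only [mul_zero, zero_add, mul_one, sub_add_cancel, add_sub_cancel_right, mul_pow,
    mul_smul, intervalIntegral.integral_smul] at hsubst
  rw [← hsubst, smul_smul, ← pow_succ']
  simp only [add_comm t₀, mul_comm]

end Division

/-! ### Orders of vanishing -/

/-- `f` vanishes at `t₀` to the exact order `k`: it is `(t - t₀) ^ k` times a smooth unit. -/
def HasOrder (f : ℝ → ℝ) (t₀ : ℝ) (k : ℕ) : Prop :=
  ∃ h : ℝ → ℝ, SmoothNear h t₀ ∧ h t₀ ≠ 0 ∧ ∀ᶠ t in 𝓝 t₀, f t = (t - t₀) ^ k * h t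

theorem isTheta_one_of_continuousAt {X : Type*} [TopologicalSpace X] {f : X → ℝ} {x : X}
    (hf : ContinuousAt f x) (h0 : f x ≠ 0) : f =Θ[𝓝 x] fun _ => (1 : ℝ) :=
  (isTheta_of_div_tendsto_nhds_ne_zero (by simpa using hf.tendsto) h0).symm

theorem le_of_pow_sub_isBigO_pow_sub {t₀ : ℝ} {k l : ℕ}
    (h : (fun t : ℝ => (t - t₀) ^ k) =O[𝓝 t₀] fun t => (t - t₀) ^ l) : l ≤ k := by
  by_contra! hlt
  have hsub : Tendsto (fun t : ℝ => t - t₀) (𝓝 t₀) (𝓝 0) := by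
    simpa using (continuous_sub_right t₀).tendsto t₀
  have hlittle := h.trans_isLittleO ((isLittleO_pow_pow hlt).comp_tendsto hsub)
  refine isLittleO_irrefl (Eventually.frequently ?_)
    (hlittle.mono (nhdsWithin_le_nhds (s := {t₀}ᶜ)))
  filter_upwards [self_mem_nhdsWithin] with t ht using pow_ne_zero k (sub_ne_zero.2 ht)

namespace HasOrder

variable {f g : ℝ → ℝ} {t₀ : ℝ} {k l : ℕ}

theorem smoothNear (hf : HasOrder f t₀ k) : SmoothNear f t₀ := by
  obtain ⟨h, hs, -, he⟩ := hf
  exact ((smoothNear_sub_pow t₀ t₀ k).mul hs).congr he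

theorem congr (hf : HasOrder f t₀ k) (hfg : g =ᶠ[𝓝 t₀] f) : HasOrder g t₀ k := by
  obtain ⟨h, hs, h0, he⟩ := hf
  exact ⟨h, hs, h0, hfg.trans he⟩

theorem eventually_ne_zero (hf : HasOrder f t₀ k) : ∀ᶠ t in 𝓝 t₀, t ≠ t₀ → f t ≠ 0 := by
  obtain ⟨h, hs, h0, he⟩ := hf
  filter_upwards [he, hs.continuousAt.eventually_ne h0] with t hft hht hne
  rw [hft]
  exact mul_ne_zero (pow_ne_zero _ (sub_ne_zero.2 hne)) hht

theorem apply_eq_zero (hf : HasOrder f t₀ k) (hk : k ≠ 0) : f t₀ = 0 := by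
  obtain ⟨h, -, -, he⟩ := hf
  rw [he.self_of_nhds, sub_self, zero_pow hk, zero_mul]

theorem apply_ne_zero (hf : HasOrder f t₀ 0) : f t₀ ≠ 0 := by
  obtain ⟨h, -, h0, he⟩ := hf
  simpa only [he.self_of_nhds, pow_zero, one_mul] using h0

theorem of_apply_ne_zero (hf : SmoothNear f t₀) (h0 : f t₀ ≠ 0) : HasOrder f t₀ 0 :=
  ⟨f, hf, h0, by simp⟩

theorem eq_zero_of_apply_ne_zero (hf : HasOrder f t₀ k) (h0 : f t₀ ≠ 0) : k = 0 :=
  by_contra fun hk => h0 (hf.apply_eq_zero hk)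

theorem mul (hf : HasOrder f t₀ k) (hg : HasOrder g t₀ l) :
    HasOrder (fun t => f t * g t) t₀ (k + l) := by
  obtain ⟨p, hp, hp0, hfp⟩ := hf
  obtain ⟨q, hq, hq0, hgq⟩ := hg
  refine ⟨fun t => p t * q t, hp.mul hq, mul_ne_zero hp0 hq0, ?_⟩
  filter_upwards [hfp, hgq] with t hft hgt
  rw [hft, hgt]; ring

theorem neg (hf : HasOrder f t₀ k) : HasOrder (fun t => -f t) t₀ k := by
  obtain ⟨p, hp, hp0, hfp⟩ := hf
  refine ⟨fun t => -p t, hp.neg, neg_ne_zero.2 hp0, ?_⟩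
  filter_upwards [hfp] with t hft
  rw [hft]; ring

theorem exists_quotient (hf : HasOrder f t₀ (k + l)) (hg : HasOrder g t₀ k) :
    ∃ q, HasOrder q t₀ l ∧ ∀ᶠ t in 𝓝 t₀, f t = q t * g t := by
  obtain ⟨p, hp, hp0, hfp⟩ := hf
  obtain ⟨r, hr, hr0, hgr⟩ := hg
  refine ⟨fun t => (t - t₀) ^ l * (p t / r t), ⟨_, hp.div hr hr0, div_ne_zero hp0 hr0, by simp⟩, ?_⟩
  filter_upwards [hfp, hgr, hr.continuousAt.eventually_ne hr0] with t hft hgt hrt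
  rw [hft, hgt]; field_simp; ring

theorem isTheta (hf : HasOrder f t₀ k) : f =Θ[𝓝 t₀] fun t => (t - t₀) ^ k := by
  obtain ⟨h, hs, h0, he⟩ := hf
  simpa using EventuallyEq.trans_isTheta he
    ((isTheta_refl (fun t : ℝ => (t - t₀) ^ k) _).mul
      (isTheta_one_of_continuousAt hs.continuousAt h0))

theorem eq_of_comp {A B s : ℝ → ℝ} {s' : ℝ} (hf : HasOrder f t₀ k) (hs : HasDerivAt s s' t₀)
    (hs' : s' ≠ 0) (hg : HasOrder g (s t₀) l) (hA : ContinuousAt A t₀) (hA0 : A t₀ ≠ 0)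
    (hB : ContinuousAt B t₀) (hB0 : B t₀ ≠ 0) (h : ∀ᶠ t in 𝓝 t₀, f t * A t = g (s t) * B t) :
    k = l := by
  have hpair : Tendsto (fun t => (t, t₀)) (𝓝 t₀) (𝓝 t₀ ×ˢ pure t₀) :=
    tendsto_id.prodMk tendsto_const_pure
  have hsub : (fun t => s t - s t₀) =Θ[𝓝 t₀] fun t => t - t₀ :=
    have h := HasDerivAtFilter.isTheta_sub hs hs'
    ⟨h.1.comp_tendsto hpair, h.2.comp_tendsto hpair⟩
  have hgs : (fun t => g (s t)) =Θ[𝓝 t₀] fun t => (s t - s t₀) ^ l :=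
    ⟨hg.isTheta.1.comp_tendsto hs.continuousAt, hg.isTheta.2.comp_tendsto hs.continuousAt⟩
  have hfA := hf.isTheta.mul (isTheta_one_of_continuousAt hA hA0)
  have hgB := (hgs.trans (hsub.pow l)).mul
    (isTheta_one_of_continuousAt hB hB0)
  have hpow := (hfA.symm.trans_eventuallyEq h).trans hgB
  simp only [mul_one] at hpow
  exact le_antisymm (le_of_pow_sub_isBigO_pow_sub hpow.2) (le_of_pow_sub_isBigO_pow_sub hpow.1)

theorem deriv (hf : HasOrder f t₀ (k + 1)) : HasOrder (deriv f) t₀ k := by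
  obtain ⟨p, hs, h0, he⟩ := hf
  refine ⟨fun t => (k + 1) * p t + (t - t₀) * _root_.deriv p t, ((smoothNear_const _ _).mul hs).add
    ((by simpa using smoothNear_sub_pow t₀ t₀ 1 : SmoothNear (· - t₀) t₀).mul hs.deriv), ?_, ?_⟩
  · simp only [sub_self, zero_mul, add_zero]
    exact mul_ne_zero (by positivity) h0
  · filter_upwards [eventually_eventually_nhds.2 he, hs.eventually] with t het hst
    have hpow : HasDerivAt (fun t : ℝ => (t - t₀) ^ (k + 1)) ((k + 1) * (t - t₀) ^ k) t :=
      (((hasDerivAt_id t).sub_const t₀).fun_pow (k + 1)).congr_deriv (by simp)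
    rw [EventuallyEq.deriv_eq het, (hpow.fun_mul hst.differentiableAt.hasDerivAt).deriv]
    ring

theorem of_deriv (hs : SmoothNear f t₀) (h0 : f t₀ = 0) (hf : HasOrder (_root_.deriv f) t₀ k) :
    HasOrder f t₀ (k + 1) := by
  obtain ⟨p, hp, hp0, he⟩ := hf
  obtain ⟨g, hg, hpg⟩ := hp.exists_contDiff
  have hgc := hg.continuous
  refine ⟨fun t => ∫ s in (0 : ℝ)..1, s ^ k • g (t₀ + s * (t - t₀)),
    smoothNear_of_contDiff (contDiff_integral_pow_smul hg t₀ k) t₀, ?_, ?_⟩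
  · simp only [sub_self, mul_zero, add_zero, smul_eq_mul, intervalIntegral.integral_mul_const,
      integral_pow, one_pow, ne_eq, Nat.add_eq_zero_iff, one_ne_zero, and_false,
      not_false_eq_true, zero_pow, sub_zero, ← hpg.self_of_nhds]
    exact mul_ne_zero (by positivity) hp0
  · obtain ⟨r, hr, hball⟩ := Metric.eventually_nhds_iff_ball.1 (he.and (hpg.and hs.eventually))
    filter_upwards [Metric.ball_mem_nhds t₀ hr] with t ht
    have hsub : Set.uIcc t₀ t ⊆ Metric.ball t₀ r :=
      (convex_ball t₀ r).ordConnected.uIcc_subset (Metric.mem_ball_self hr) ht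
    have hFTC : ∫ x in t₀..t, (x - t₀) ^ k • g x = f t - f t₀ := by
      refine intervalIntegral.integral_eq_sub_of_hasDerivAt (fun x hx => ?_)
        (Continuous.intervalIntegrable (by fun_prop) _ _)
      obtain ⟨hfx, hgx, hsx⟩ := hball x (hsub hx)
      rw [← hgx, smul_eq_mul, ← hfx]
      exact hsx.differentiableAt.hasDerivAt
    rw [integral_pow_smul_comp_affine, h0, sub_zero] at hFTC
    exact hFTC.symm

theorem iteratedDeriv_eq_zero {j : ℕ} (hf : HasOrder f t₀ k) (hj : j < k) :
    iteratedDeriv j f t₀ = 0 := by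
  induction k generalizing f j with
  | zero => omega
  | succ k ih =>
    cases j with
    | zero => simpa using hf.apply_eq_zero (by simp)
    | succ j => rw [iteratedDeriv_succ']; exact ih hf.deriv (by omega)

theorem iteratedDeriv_ne_zero (hf : HasOrder f t₀ k) : iteratedDeriv k f t₀ ≠ 0 := by
  induction k generalizing f with
  | zero => simpa using hf.apply_ne_zero
  | succ k ih => rw [iteratedDeriv_succ']; exact ih hf.deriv

theorem of_iteratedDeriv (hs : SmoothNear f t₀) (h0 : ∀ j < k, iteratedDeriv j f t₀ = 0)
    (hk : iteratedDeriv k f t₀ ≠ 0) : HasOrder f t₀ k := by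
  induction k generalizing f with
  | zero => exact of_apply_ne_zero hs (by simpa using hk)
  | succ k ih =>
    refine of_deriv hs (by simpa using h0 0 (by simp)) (ih hs.deriv (fun j hj => ?_) ?_)
    · rw [← iteratedDeriv_succ']; exact h0 _ (by omega)
    · rwa [← iteratedDeriv_succ']

end HasOrder

/-! ### Germs of diffeomorphisms and right-left equivalence -/

section Germs

variable {E F G H : Type} [NormedAddCommGroup E] [NormedSpace ℝ E]
  [NormedAddCommGroup F] [NormedSpace ℝ F] [NormedAddCommGroup G] [NormedSpace ℝ G]
  [NormedAddCommGroup H] [NormedSpace ℝ H]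

/-- A germ of a diffeomorphism from a neighbourhood of `p` to a neighbourhood of `q`, given by
globally defined representatives of the germ and of its inverse. -/
structure DiffeoGerm (p : E) (q : F) where
  toFun : E → F
  invFun : F → E
  smooth : SmoothNear toFun p
  smooth_inv : SmoothNear invFun q
  map_base : toFun p = q
  inv_base : invFun q = p
  left_inv : ∀ᶠ x in 𝓝 p, invFun (toFun x) = x
  right_inv : ∀ᶠ y in 𝓝 q, toFun (invFun y) = y

namespace DiffeoGerm

variable {p : E} {q : F} {r : G}

instance : CoeFun (DiffeoGerm p q) fun _ => E → F := ⟨toFun⟩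

def symm (φ : DiffeoGerm p q) : DiffeoGerm q p where
  toFun := φ.invFun
  invFun := φ
  smooth := φ.smooth_inv
  smooth_inv := φ.smooth
  map_base := φ.inv_base
  inv_base := φ.map_base
  left_inv := φ.right_inv
  right_inv := φ.left_inv

theorem tendsto (φ : DiffeoGerm p q) : Tendsto φ (𝓝 p) (𝓝 q) := by
  simpa only [ContinuousAt, φ.map_base] using φ.smooth.continuousAt

theorem smoothNear_comp (φ : DiffeoGerm p q) {f : F → G} (hf : SmoothNear f q) :
    SmoothNear (fun x => f (φ x)) p :=
  SmoothNear.comp (by rwa [φ.map_base]) φ.smooth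

def trans (φ : DiffeoGerm p q) (ψ : DiffeoGerm q r) : DiffeoGerm p r where
  toFun x := ψ (φ x)
  invFun y := φ.symm (ψ.symm y)
  smooth := φ.smoothNear_comp ψ.smooth
  smooth_inv := ψ.symm.smoothNear_comp φ.symm.smooth
  map_base := by rw [φ.map_base, ψ.map_base]
  inv_base := by rw [ψ.symm.map_base, φ.symm.map_base]
  left_inv := by
    filter_upwards [φ.left_inv, φ.tendsto.eventually ψ.left_inv] with x hφ hψ
    exact (congrArg φ.invFun hψ).trans hφ
  right_inv := by
    filter_upwards [ψ.right_inv, ψ.symm.tendsto.eventually φ.right_inv] with y hψ hφ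
    exact (congrArg ψ hφ).trans hψ

theorem fderiv_symm_fderiv (φ : DiffeoGerm p q) (v : E) :
    fderiv ℝ φ.symm q (fderiv ℝ φ p v) = v := by
  have hφ : HasFDerivAt φ (fderiv ℝ φ p) p := φ.smooth.differentiableAt.hasFDerivAt
  have hψ : HasFDerivAt φ.symm (fderiv ℝ φ.symm q) (φ p) := by
    rw [φ.map_base]; exact φ.symm.smooth.differentiableAt.hasFDerivAt
  have hid := (hψ.comp p hφ).congr_of_eventuallyEq (f₁ := id) (φ.left_inv.mono fun x hx => hx.symm)
  exact DFunLike.congr_fun (hid.unique (hasFDerivAt_id p)) v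

theorem fderiv_injective (φ : DiffeoGerm p q) : Function.Injective (fderiv ℝ φ p) :=
  Function.LeftInverse.injective φ.fderiv_symm_fderiv

def ofOpenPartialHomeomorph {p q : E} {φ : OpenPartialHomeomorph E E} (hφ : IsDiffeo φ)
    (hp : p ∈ φ.source) (hq : φ p = q) : DiffeoGerm p q where
  toFun := φ
  invFun := φ.symm
  smooth := by
    filter_upwards [φ.open_source.mem_nhds hp] with y hy
    exact hφ.1.contDiffAt (φ.open_source.mem_nhds hy)
  smooth_inv := by
    filter_upwards [φ.open_target.mem_nhds (hq ▸ φ.map_source hp)] with y hy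
    exact hφ.2.contDiffAt (φ.open_target.mem_nhds hy)
  map_base := hq
  inv_base := hq ▸ φ.left_inv hp
  left_inv := φ.eventually_left_inverse hp
  right_inv := φ.eventually_right_inverse (hq ▸ φ.map_source hp)

end DiffeoGerm

/-- A right-left equivalence between the germ of `f` at `p` and the germ of `g` at `q`, as data:
the diffeomorphism-germs of the sources and of the targets. -/
structure GermEquiv (f : E → F) (p : E) (g : G → H) (q : G) where
  source : DiffeoGerm p q
  target : DiffeoGerm (f p) (g q)
  comm : ∀ᶠ z in 𝓝 p, target (f z) = g (source z)

theorem RightLeftEquiv.nonempty_germEquiv {f g : ℝ × ℝ → E3} {p q : ℝ × ℝ}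
    (h : RightLeftEquiv f p g q) : Nonempty (GermEquiv f p g q) := by
  obtain ⟨σ, τ, hσ, hτ, hp, hq, hfp, he⟩ := h
  exact ⟨⟨.ofOpenPartialHomeomorph hσ hp hq,
    .ofOpenPartialHomeomorph hτ hfp (hq ▸ he.self_of_nhds), he⟩⟩

namespace GermEquiv

variable {f : E → F} {g : G → H} {p : E} {q : G}

def symm (e : GermEquiv f p g q) (hf : ContinuousAt f p) : GermEquiv g q f p where
  source := e.source.symm
  target := e.target.symm
  comm := by
    filter_upwards [e.source.right_inv, e.source.symm.tendsto.eventually e.comm,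
      e.source.symm.tendsto.eventually (hf.eventually e.target.left_inv)] with w hw hcomm hleft
    exact (congrArg e.target.invFun (hcomm.trans (congrArg g hw)).symm).trans hleft

def trans {E' F' : Type} [NormedAddCommGroup E'] [NormedSpace ℝ E'] [NormedAddCommGroup F']
    [NormedSpace ℝ F'] {k : E' → F'} {r : E'} (e : GermEquiv f p g q) (e' : GermEquiv g q k r) :
    GermEquiv f p k r where
  source := e.source.trans e'.source
  target := e.target.trans e'.target
  comm := by
    filter_upwards [e.comm, e.source.tendsto.eventually e'.comm] with z hz hz'
    exact (congrArg e'.target hz).trans hz'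

/-- The derivative of the target diffeomorphism along the map `f`. -/
def jet (e : GermEquiv f p g q) (z : E) : F →L[ℝ] H := fderiv ℝ e.target (f z)

theorem smoothNear_jet (e : GermEquiv f p g q) (hf : SmoothNear f p) : SmoothNear e.jet p :=
  e.target.smooth.fderiv.comp hf

theorem jet_injective (e : GermEquiv f p g q) : Function.Injective (e.jet p) :=
  e.target.fderiv_injective

theorem jet_fderiv (e : GermEquiv f p g q) (hf : SmoothNear f p) (hg : SmoothNear g q) :
    ∀ᶠ z in 𝓝 p, ∀ v,
      e.jet z (fderiv ℝ f z v) = fderiv ℝ g (e.source z) (fderiv ℝ e.source z v) := by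
  filter_upwards [hf, hf.continuousAt.eventually e.target.smooth, e.source.smooth,
    e.source.tendsto.eventually hg, eventually_eventually_nhds.2 e.comm]
    with z hfz hτz hσz hgz hcomm v
  have differentiable {E F : Type} [NormedAddCommGroup E] [NormedSpace ℝ E]
      [NormedAddCommGroup F] [NormedSpace ℝ F] {f : E → F} {x : E} (h : ContDiffAt ℝ ∞ f x) :=
    (h.differentiableAt (by simp)).hasFDerivAt
  have hτf := (differentiable hτz).comp z (differentiable hfz)
  have hgσ := (differentiable hgz).comp z (differentiable hσz)
  exact DFunLike.congr_fun (hτf.unique (hgσ.congr_of_eventuallyEq hcomm)) v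

theorem fderiv_jet_eq_zero (e : GermEquiv f p g q) (hf : SmoothNear f p) :
    ∀ᶠ z in 𝓝 p, ∀ v, fderiv ℝ f z v = 0 → fderiv ℝ e.jet z v = 0 := by
  filter_upwards [hf.eventually, hf.continuousAt.eventually e.target.smooth.fderiv.eventually]
    with z hfz hτz v hv
  have hcomp := hτz.differentiableAt.hasFDerivAt.comp z hfz.differentiableAt.hasFDerivAt
  have : fderiv ℝ e.jet z v = _ := DFunLike.congr_fun hcomp.fderiv v
  simpa [hv] using this

end GermEquiv

end Germs

/-! ### Developables in normal form -/

section Ruled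

theorem eventually_fst {t₀ : ℝ} {P : ℝ → Prop} (h : ∀ᶠ t in 𝓝 t₀, P t) (u : ℝ) :
    ∀ᶠ z in 𝓝 (t₀, u), P z.1 :=
  (continuous_fst.tendsto (t₀, u)).eventually h

theorem eventually_axis {t₀ : ℝ} {P : ℝ × ℝ → Prop} (h : ∀ᶠ z in 𝓝 (t₀, (0 : ℝ)), P z) :
    ∀ᶠ t in 𝓝 t₀, P (t, 0) :=
  ((Continuous.prodMk_left (0 : ℝ)).tendsto t₀).eventually h

theorem hasFDerivAt_ruled {F : Type*} [NormedAddCommGroup F] [NormedSpace ℝ F] {c h : ℝ → F}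
    {z : ℝ × ℝ} (hc : DifferentiableAt ℝ c z.1) (hh : DifferentiableAt ℝ h z.1) :
    HasFDerivAt (fun z : ℝ × ℝ => c z.1 + z.2 • h z.1)
      ((ContinuousLinearMap.fst ℝ ℝ ℝ).smulRight (deriv c z.1 + z.2 • deriv h z.1) +
        (ContinuousLinearMap.snd ℝ ℝ ℝ).smulRight (h z.1)) z := by
  have hcz := hc.hasDerivAt.hasFDerivAt.comp z (hasFDerivAt_fst (𝕜 := ℝ) (p := z))
  have hhz := hh.hasDerivAt.hasFDerivAt.comp z (hasFDerivAt_fst (𝕜 := ℝ) (p := z))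
  refine (hcz.add ((hasFDerivAt_snd (𝕜 := ℝ) (p := z)).smul hhz)).congr_fderiv ?_
  ext <;> simp

theorem eventually_eq_zero_of_off_axes {φ : ℝ × ℝ → ℝ} {t₀ u₀ : ℝ}
    (hφ : ∀ᶠ z in 𝓝 (t₀, u₀), ContinuousAt φ z)
    (h : ∀ᶠ z in 𝓝 (t₀, u₀), z.1 ≠ t₀ → z.2 ≠ u₀ → φ z = 0) :
    ∀ᶠ z in 𝓝 (t₀, u₀), φ z = 0 := by
  have hdense : Dense (({t₀}ᶜ : Set ℝ) ×ˢ ({u₀}ᶜ : Set ℝ)) :=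
    (dense_compl_singleton t₀).prod (dense_compl_singleton u₀)
  filter_upwards [hφ, eventually_eventually_nhds.2 h] with z hcont hz
  have hfreq : ∃ᶠ w in 𝓝 z, φ w ∈ ({0} : Set ℝ) :=
    ((mem_closure_iff_frequently.1 (hdense z)).and_eventually hz).mono
      fun w hw => hw.2 hw.1.1 hw.1.2
  exact isClosed_singleton.mem_of_frequently_of_tendsto hfreq hcont

end Ruled

/-- A curve `(c₁, c₂, c₃)` near `t₀` whose tangent direction `(1, h₂, h₃)` and second osculating
direction `(0, 1, k)` extend smoothly to `t₀`. -/
structure DevCurve (t₀ : ℝ) where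
  (c₁ c₂ c₃ h₂ h₃ k : ℝ → ℝ)
  smooth_c₁ : SmoothNear c₁ t₀
  smooth_c₂ : SmoothNear c₂ t₀
  smooth_c₃ : SmoothNear c₃ t₀
  smooth_h₂ : SmoothNear h₂ t₀
  smooth_h₃ : SmoothNear h₃ t₀
  smooth_k : SmoothNear k t₀
  deriv_c₂ : ∀ᶠ t in 𝓝 t₀, deriv c₂ t = h₂ t * deriv c₁ t
  deriv_c₃ : ∀ᶠ t in 𝓝 t₀, deriv c₃ t = h₃ t * deriv c₁ t
  deriv_h₃ : ∀ᶠ t in 𝓝 t₀, deriv h₃ t = k t * deriv h₂ t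

namespace DevCurve

variable {t₀ : ℝ} (D : DevCurve t₀)

/-- The orders of vanishing that determine the type of the curve, which is
`(a + 1, a + b + 2, a + b + d + 3)`. -/
structure HasOrders (a b d : ℕ) : Prop where
  order_c₁ : HasOrder (deriv D.c₁) t₀ a
  order_h₂ : HasOrder (deriv D.h₂) t₀ b
  order_k : HasOrder (deriv D.k) t₀ d

/-- The underlying curve in affine three-space. -/
def curve (t : ℝ) : E3 := ![D.c₁ t, D.c₂ t, D.c₃ t]

/-- The direction of the tangent line. -/
def tangent (t : ℝ) : E3 := ![1, D.h₂ t, D.h₃ t]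

/-- A direction that spans the osculating plane together with the tangent direction. -/
def second (t : ℝ) : E3 := ![0, 1, D.k t]

/-- The coordinate along `second` in the frame `tangent`, `second`, `(0, 0, 1)`. -/
def secondCoord (t : ℝ) : E3 →L[ℝ] ℝ :=
  ContinuousLinearMap.proj 1 - D.h₂ t • ContinuousLinearMap.proj 0

/-- The coordinate along `(0, 0, 1)` in the frame `tangent`, `second`, `(0, 0, 1)`; its kernel is
the direction of the osculating plane. -/
def conormal (t : ℝ) : E3 →L[ℝ] ℝ :=
  ContinuousLinearMap.proj 2 - D.h₃ t • ContinuousLinearMap.proj 0 - D.k t • D.secondCoord t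

/-- The tangent developable of the curve. -/
def surface (z : ℝ × ℝ) : E3 := D.curve z.1 + z.2 • D.tangent z.1

/-- The direction at `z` that `surface` kills up to a vector along `second`. -/
def kernelDir (z : ℝ × ℝ) : ℝ × ℝ := (1, -deriv D.c₁ z.1)

theorem tangent_apply_zero (t : ℝ) : D.tangent t 0 = 1 := rfl

theorem second_apply_zero (t : ℝ) : D.second t 0 = 0 := rfl

theorem secondCoord_tangent (t : ℝ) : D.secondCoord t (D.tangent t) = 0 := by
  simp [secondCoord, tangent]

theorem secondCoord_second (t : ℝ) : D.secondCoord t (D.second t) = 1 := by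
  simp [secondCoord, second]

theorem conormal_tangent (t : ℝ) : D.conormal t (D.tangent t) = 0 := by
  simp [conormal, secondCoord, tangent]

theorem conormal_second (t : ℝ) : D.conormal t (D.second t) = 0 := by
  simp [conormal, secondCoord, second]

theorem conormal_third (t : ℝ) : D.conormal t ![0, 0, 1] = 1 := by
  simp [conormal, secondCoord]

theorem frame_decomposition (t : ℝ) (x : E3) :
    x = x 0 • D.tangent t + D.secondCoord t x • D.second t + D.conormal t x • ![0, 0, 1] := by
  ext i
  fin_cases i
  · simp [tangent, second]
  · simp [secondCoord, tangent, second]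
    ring
  · simp [conormal, secondCoord, tangent, second]
    ring

theorem smoothNear_curve : SmoothNear D.curve t₀ :=
  .pi fun i => by fin_cases i; exacts [D.smooth_c₁, D.smooth_c₂, D.smooth_c₃]

theorem smoothNear_tangent : SmoothNear D.tangent t₀ :=
  .pi fun i => by fin_cases i; exacts [smoothNear_const _ _, D.smooth_h₂, D.smooth_h₃]

theorem smoothNear_second : SmoothNear D.second t₀ :=
  .pi fun i => by fin_cases i; exacts [smoothNear_const _ _, smoothNear_const _ _, D.smooth_k]

theorem smoothNear_secondCoord : SmoothNear D.secondCoord t₀ :=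
  (smoothNear_const _ _).sub (D.smooth_h₂.smul (smoothNear_const _ _))

theorem smoothNear_conormal : SmoothNear D.conormal t₀ :=
  ((smoothNear_const _ _).sub (D.smooth_h₃.smul (smoothNear_const _ _))).sub
    (D.smooth_k.smul D.smoothNear_secondCoord)

theorem smoothNear_surface : SmoothNear D.surface (t₀, 0) :=
  (SmoothNear.comp_fst D.smoothNear_curve).add
    (SmoothNear.smul (smoothNear_of_contDiff contDiff_snd _) (.comp_fst D.smoothNear_tangent))

theorem smoothNear_kernelDir : SmoothNear D.kernelDir (t₀, 0) :=
  (smoothNear_const _ _).prodMk (SmoothNear.comp_fst (f := deriv D.c₁) D.smooth_c₁.deriv).neg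

theorem deriv_curve : ∀ᶠ t in 𝓝 t₀, deriv D.curve t = deriv D.c₁ t • D.tangent t := by
  filter_upwards [D.smoothNear_curve.eventually, D.deriv_c₂, D.deriv_c₃] with t hs h₂ h₃
  rw [deriv_pi fun i => (hs.apply i).differentiableAt]
  ext i
  fin_cases i
  · simp [curve, tangent]
  · simpa [curve, tangent, mul_comm] using h₂
  · simpa [curve, tangent, mul_comm] using h₃

theorem deriv_tangent : ∀ᶠ t in 𝓝 t₀, deriv D.tangent t = deriv D.h₂ t • D.second t := by
  filter_upwards [D.smoothNear_tangent.eventually, D.deriv_h₃] with t hs h₃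
  rw [deriv_pi fun i => (hs.apply i).differentiableAt]
  ext i
  fin_cases i
  · simp [tangent, second]
  · simp [tangent, second]
  · simpa [tangent, second, mul_comm] using h₃

theorem deriv_second : ∀ᶠ t in 𝓝 t₀, deriv D.second t = deriv D.k t • ![0, 0, 1] := by
  filter_upwards [D.smoothNear_second.eventually] with t hs
  rw [deriv_pi fun i => (hs.apply i).differentiableAt]
  ext i
  fin_cases i <;> simp [second]

theorem deriv_conormal :
    ∀ᶠ t in 𝓝 t₀, deriv D.conormal t = -(deriv D.k t • D.secondCoord t) := by
  filter_upwards [D.smooth_h₂.eventually, D.smooth_h₃.eventually, D.smooth_k.eventually,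
    D.deriv_h₃] with t hh₂ hh₃ hk h₃
  have hθ : HasDerivAt D.secondCoord _ t :=
    (hh₂.differentiableAt.hasDerivAt.smul_const _).const_sub _
  have hν : HasDerivAt D.conormal _ t :=
    ((hh₃.differentiableAt.hasDerivAt.smul_const _).const_sub _).sub
      (hk.differentiableAt.hasDerivAt.smul hθ)
  rw [hν.deriv, h₃]
  module

theorem fderiv_surface : ∀ᶠ z in 𝓝 (t₀, (0 : ℝ)), ∀ v, fderiv ℝ D.surface z v =
    (v.1 * deriv D.c₁ z.1 + v.2) • D.tangent z.1 +
      (v.1 * (z.2 * deriv D.h₂ z.1)) • D.second z.1 := by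
  filter_upwards [eventually_fst (D.smoothNear_curve.eventually.and D.deriv_curve) 0,
    eventually_fst (D.smoothNear_tangent.eventually.and D.deriv_tangent) 0]
    with z ⟨hc, hc'⟩ ⟨hh, hh'⟩ v
  have hfderiv : fderiv ℝ D.surface z = _ :=
    (hasFDerivAt_ruled hc.differentiableAt hh.differentiableAt).fderiv
  simp only [hfderiv, hc', hh', add_apply, ContinuousLinearMap.smulRight_apply,
    ContinuousLinearMap.coe_fst', ContinuousLinearMap.coe_snd']
  module

theorem fderiv_surface_kernelDir : ∀ᶠ z in 𝓝 (t₀, (0 : ℝ)),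
    fderiv ℝ D.surface z (D.kernelDir z) = (z.2 * deriv D.h₂ z.1) • D.second z.1 := by
  filter_upwards [D.fderiv_surface] with z hz
  simp [hz, kernelDir]

end DevCurve

/-! ### Equivalent developables have the same orders -/

namespace GermEquiv

variable {t₀ t₀' : ℝ} {D : DevCurve t₀} {D' : DevCurve t₀'} {a b d a' b' d' : ℕ}
  (e : GermEquiv D.surface (t₀, 0) D'.surface (t₀', 0))

/-- The speed, in the parameter of the second curve, of the image of the direction `kernelDir`. -/
def speed (z : ℝ × ℝ) : ℝ := (fderiv ℝ e.source z (D.kernelDir z)).1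

/-- The coordinate along `D'.second` of the image of `D.second`. -/
def secondFactor (z : ℝ × ℝ) : ℝ := D'.secondCoord (e.source z).1 (e.jet z (D.second z.1))

/-- The coordinate along `(0, 0, 1)` of the image of `(0, 0, 1)`. -/
def conormalFactor (z : ℝ × ℝ) : ℝ := D'.conormal (e.source z).1 (e.jet z ![0, 0, 1])

theorem smoothNear_speed : SmoothNear e.speed (t₀, 0) :=
  (e.source.smooth.fderiv.clm_apply D.smoothNear_kernelDir).fst

theorem smoothNear_secondFactor : SmoothNear e.secondFactor (t₀, 0) :=
  (e.source.smoothNear_comp (.comp_fst D'.smoothNear_secondCoord)).clm_apply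
    ((e.smoothNear_jet D.smoothNear_surface).clm_apply (.comp_fst D.smoothNear_second))

theorem smoothNear_conormalFactor : SmoothNear e.conormalFactor (t₀, 0) :=
  (e.source.smoothNear_comp (.comp_fst D'.smoothNear_conormal)).clm_apply
    ((e.smoothNear_jet D.smoothNear_surface).clm_apply (smoothNear_const _ _))

theorem jet_fderiv_surface : ∀ᶠ z in 𝓝 (t₀, (0 : ℝ)), ∀ v,
    e.jet z (fderiv ℝ D.surface z v) =
      ((fderiv ℝ e.source z v).1 * deriv D'.c₁ (e.source z).1 + (fderiv ℝ e.source z v).2) •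
        D'.tangent (e.source z).1 +
      ((fderiv ℝ e.source z v).1 * ((e.source z).2 * deriv D'.h₂ (e.source z).1)) •
        D'.second (e.source z).1 := by
  filter_upwards [e.jet_fderiv D.smoothNear_surface D'.smoothNear_surface,
    e.source.tendsto.eventually D'.fderiv_surface] with z hz hz' v
  rw [hz, hz']

theorem conormal_jet_tangent : ∀ᶠ z in 𝓝 (t₀, (0 : ℝ)),
    D'.conormal (e.source z).1 (e.jet z (D.tangent z.1)) = 0 := by
  filter_upwards [e.jet_fderiv_surface, D.fderiv_surface] with z hz hsurf
  simpa [hsurf, DevCurve.conormal_tangent, DevCurve.conormal_second] using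
    congrArg (D'.conormal (e.source z).1) (hz (0, 1))

theorem mul_secondFactor : ∀ᶠ z in 𝓝 (t₀, (0 : ℝ)), z.2 * deriv D.h₂ z.1 * e.secondFactor z =
    e.speed z * ((e.source z).2 * deriv D'.h₂ (e.source z).1) := by
  filter_upwards [e.jet_fderiv_surface, D.fderiv_surface_kernelDir] with z hz hsurf
  simpa [hsurf, secondFactor, speed, DevCurve.secondCoord_tangent,
    DevCurve.secondCoord_second] using
    congrArg (D'.secondCoord (e.source z).1) (hz (D.kernelDir z))

/-- The image of the osculating plane is the osculating plane: where the surface is immersed both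
are its tangent plane, and these points are dense. -/
theorem conormal_jet_second (hD : D.HasOrders a b d) : ∀ᶠ z in 𝓝 (t₀, (0 : ℝ)),
    D'.conormal (e.source z).1 (e.jet z (D.second z.1)) = 0 := by
  have hsmooth : SmoothNear (fun z => D'.conormal (e.source z).1 (e.jet z (D.second z.1)))
      (t₀, 0) :=
    (e.source.smoothNear_comp (.comp_fst D'.smoothNear_conormal)).clm_apply
      ((e.smoothNear_jet D.smoothNear_surface).clm_apply (.comp_fst D.smoothNear_second))
  refine eventually_eq_zero_of_off_axes (hsmooth.mono fun z hz => hz.continuousAt) ?_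
  filter_upwards [e.jet_fderiv_surface, D.fderiv_surface_kernelDir,
    eventually_fst hD.order_h₂.eventually_ne_zero 0] with z hz hsurf hne ht hu
  have hzero := congrArg (D'.conormal (e.source z).1) (hz (D.kernelDir z))
  simpa [hsurf, DevCurve.conormal_tangent, DevCurve.conormal_second, hu, hne ht] using hzero

/-- Along the curve the target diffeomorphism is stationary in the direction `kernelDir`, so that
the derivative of `conormal_jet_second` only sees the frames. -/
theorem mul_conormalFactor (hD : D.HasOrders a b d) : ∀ᶠ t in 𝓝 t₀,
    deriv D.k t * e.conormalFactor (t, 0) =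
      deriv D'.k (e.source (t, 0)).1 * (e.speed (t, 0) * e.secondFactor (t, 0)) := by
  have base {P : ℝ → Prop} (h : ∀ᶠ t in 𝓝 t₀', P t) : ∀ᶠ t in 𝓝 t₀, P (e.source (t, 0)).1 :=
    eventually_axis (e.source.tendsto.eventually (eventually_fst h 0))
  filter_upwards [eventually_axis (eventually_eventually_nhds.2 (e.conormal_jet_second hD)),
    eventually_axis e.source.smooth.eventually, base D'.smoothNear_conormal.eventually,
    base D'.deriv_conormal, eventually_axis (e.smoothNear_jet D.smoothNear_surface).eventually,
    eventually_axis (e.fderiv_jet_eq_zero D.smoothNear_surface),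
    eventually_axis D.fderiv_surface_kernelDir, D.smoothNear_second.eventually, D.deriv_second]
    with t hzero hσ hν hν' hT hT' hker hs hs'
  have hνσ := hν.differentiableAt.hasDerivAt.hasFDerivAt.comp (t, (0 : ℝ))
    hσ.differentiableAt.hasFDerivAt.fst
  have hsfst := HasFDerivAt.comp (f := Prod.fst) (t, (0 : ℝ))
    hs.differentiableAt.hasDerivAt.hasFDerivAt hasFDerivAt_fst
  have hprod := hνσ.clm_apply (hT.differentiableAt.hasFDerivAt.clm_apply hsfst)
  have hconst := (hasFDerivAt_const (𝕜 := ℝ) (0 : ℝ) (t, (0 : ℝ))).congr_of_eventuallyEq hzero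
  have hval := DFunLike.congr_fun (hprod.unique hconst) (D.kernelDir (t, 0))
  have hstationary := hT' (D.kernelDir (t, 0)) (by simpa using hker)
  have hK : (D.kernelDir (t, 0)).1 = 1 := rfl
  have hsum : deriv D.k t * e.conormalFactor (t, 0) -
      e.speed (t, 0) * (deriv D'.k (e.source (t, 0)).1 * e.secondFactor (t, 0)) = 0 := by
    simpa [hs', hν', hstationary, conormalFactor, secondFactor, speed, hK, sub_eq_add_neg,
      -Matrix.smul_cons] using hval
  linear_combination hsum

theorem secondCoord_jet_tangent :
    D'.secondCoord t₀' (e.jet (t₀, 0) (D.tangent t₀)) = 0 := by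
  have hz := e.jet_fderiv_surface.self_of_nhds (0, 1)
  simpa [D.fderiv_surface.self_of_nhds, e.source.map_base, DevCurve.secondCoord_tangent] using
    congrArg (D'.secondCoord t₀') hz

theorem jet_tangent_apply_zero_ne_zero : e.jet (t₀, 0) (D.tangent t₀) 0 ≠ 0 := by
  intro hzero
  have hν := e.conormal_jet_tangent.self_of_nhds
  rw [e.source.map_base] at hν
  have hjet : e.jet (t₀, 0) (D.tangent t₀) = 0 := by
    rw [D'.frame_decomposition t₀' (e.jet _ _), hzero, e.secondCoord_jet_tangent, hν]
    simp
  have htangent := e.jet_injective (hjet.trans (map_zero _).symm)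
  simpa [DevCurve.tangent] using congrFun htangent 0

theorem jet_surjective : Function.Surjective (e.jet (t₀, 0)) :=
  LinearMap.surjective_of_injective (f := (e.jet (t₀, 0)).toLinearMap) e.jet_injective

theorem conormal_jet (hD : D.HasOrders a b d) (x : E3) :
    D'.conormal t₀' (e.jet (t₀, 0) x) = D.conormal t₀ x * e.conormalFactor (t₀, 0) := by
  have htangent := e.conormal_jet_tangent.self_of_nhds
  have hsecond := (e.conormal_jet_second hD).self_of_nhds
  rw [e.source.map_base] at htangent hsecond
  conv_lhs => rw [D.frame_decomposition t₀ x]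
  simp only [map_add, map_smul, htangent, hsecond, conormalFactor, e.source.map_base, smul_eq_mul,
    mul_zero, zero_add]

theorem secondCoord_jet (x : E3) : D'.secondCoord t₀' (e.jet (t₀, 0) x) =
    D.secondCoord t₀ x * e.secondFactor (t₀, 0) +
      D.conormal t₀ x * D'.secondCoord t₀' (e.jet (t₀, 0) ![0, 0, 1]) := by
  conv_lhs => rw [D.frame_decomposition t₀ x]
  simp only [map_add, map_smul, e.secondCoord_jet_tangent, secondFactor, e.source.map_base,
    smul_eq_mul, mul_zero, zero_add]

theorem conormalFactor_ne_zero (hD : D.HasOrders a b d) : e.conormalFactor (t₀, 0) ≠ 0 := by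
  intro hzero
  obtain ⟨x, hx⟩ := e.jet_surjective ![0, 0, 1]
  simpa [hx, hzero, DevCurve.conormal_third] using e.conormal_jet hD x

theorem secondFactor_ne_zero (hD : D.HasOrders a b d) : e.secondFactor (t₀, 0) ≠ 0 := by
  intro hzero
  obtain ⟨x, hx⟩ := e.jet_surjective (D'.second t₀')
  have hν : D.conormal t₀ x = 0 := by
    simpa [hx, DevCurve.conormal_second, e.conormalFactor_ne_zero hD] using e.conormal_jet hD x
  simpa [hx, hν, hzero, DevCurve.secondCoord_second] using e.secondCoord_jet x

theorem speed_ne_zero : e.speed (t₀, 0) ≠ 0 := by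
  intro hzero
  have hjet := congrFun (e.jet_fderiv_surface.self_of_nhds (D.kernelDir (t₀, 0))) 0
  have hsnd : (fderiv ℝ e.source (t₀, 0) (D.kernelDir (t₀, 0))).2 = 0 := by
    unfold speed at hzero
    simpa [D.fderiv_surface_kernelDir.self_of_nhds, hzero, DevCurve.tangent] using hjet.symm
  have hker : D.kernelDir (t₀, 0) = 0 :=
    e.source.fderiv_injective ((Prod.ext hzero hsnd).trans (map_zero _).symm)
  exact one_ne_zero (congrArg Prod.fst hker)

theorem order_h₂_le (e : GermEquiv D.surface (t₀, 0) D'.surface (t₀', 0))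
    (hD : D.HasOrders a b d) (hD' : D'.HasOrders a' b' d') : b' ≤ b := by
  -- compare the two sides of `mul_secondFactor` along the diagonal `u = t - t₀`
  let diag : ℝ → ℝ × ℝ := fun t => (t, t - t₀)
  have hbase : diag t₀ = (t₀, 0) := Prod.ext rfl (sub_self t₀)
  have hdiag : SmoothNear diag t₀ :=
    smoothNear_of_contDiff (contDiff_id.prodMk (contDiff_id.sub contDiff_const)) t₀
  have comp {F : Type} [NormedAddCommGroup F] [NormedSpace ℝ F] {f : ℝ × ℝ → F}
      (hf : SmoothNear f (t₀, 0)) : SmoothNear (fun t => f (diag t)) t₀ :=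
    SmoothNear.comp (by rwa [hbase]) hdiag
  have hσ := comp e.source.smooth
  have hσ_base : e.source (diag t₀) = (t₀', 0) := by rw [hbase, e.source.map_base]
  have hfst : (fun t => (e.source (diag t)).1 - t₀') =O[𝓝 t₀] fun t => t - t₀ := by
    simpa only [hσ_base] using hσ.fst.differentiableAt.isBigO_sub
  have hsnd : (fun t => (e.source (diag t)).2) =O[𝓝 t₀] fun t => t - t₀ := by
    simpa only [hσ_base, sub_zero] using hσ.snd.differentiableAt.isBigO_sub
  have hh₂ : (fun t => deriv D'.h₂ (e.source (diag t)).1) =O[𝓝 t₀] fun t => (t - t₀) ^ b' :=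
    (hD'.order_h₂.isTheta.1.comp_tendsto
      (by simpa only [ContinuousAt, hσ_base] using hσ.fst.continuousAt)).trans (hfst.pow b')
  have hleft : (fun t => (t - t₀) * (t - t₀) ^ b * 1) =O[𝓝 t₀]
      fun t => (t - t₀) * deriv D.h₂ t * e.secondFactor (diag t) :=
    (((isTheta_refl (fun t => t - t₀) _).mul hD.order_h₂.isTheta).mul (isTheta_one_of_continuousAt
      (comp e.smoothNear_secondFactor).continuousAt
      (by simpa only [hbase] using e.secondFactor_ne_zero hD))).2
  have hright : (fun t => e.speed (diag t) *
      ((e.source (diag t)).2 * deriv D'.h₂ (e.source (diag t)).1)) =O[𝓝 t₀]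
      fun t => 1 * ((t - t₀) * (t - t₀) ^ b') :=
    ((comp e.smoothNear_speed).continuousAt.isBigO_one ℝ).mul (hsnd.mul hh₂)
  have heq := (hbase ▸ hdiag.continuousAt.tendsto).eventually e.mul_secondFactor
  have hpow := (hleft.trans_eventuallyEq heq).trans hright
  simp only [one_mul, mul_one, ← pow_succ'] at hpow
  exact Nat.le_of_succ_le_succ (le_of_pow_sub_isBigO_pow_sub hpow)

theorem smoothNear_source_axis : SmoothNear (fun t => e.source (t, 0)) t₀ :=
  SmoothNear.comp (f := fun t => (t, (0 : ℝ))) e.source.smooth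
    (smoothNear_of_contDiff (contDiff_id.prodMk contDiff_const) t₀)

theorem deriv_source_axis : ∀ᶠ t in 𝓝 t₀,
    deriv (fun t => e.source (t, 0)) t = fderiv ℝ e.source (t, 0) (1, 0) := by
  filter_upwards [eventually_axis e.source.smooth.eventually] with t hσ
  exact (HasFDerivAt.comp_hasDerivAt t hσ.differentiableAt.hasFDerivAt
    ((hasDerivAt_id t).prodMk (hasDerivAt_const t (0 : ℝ)))).deriv

theorem mul_jet_tangent : ∀ᶠ t in 𝓝 t₀, deriv D.c₁ t * e.jet (t, 0) (D.tangent t) 0 =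
    (fderiv ℝ e.source (t, 0) (1, 0)).1 * deriv D'.c₁ (e.source (t, 0)).1 +
      (fderiv ℝ e.source (t, 0) (1, 0)).2 := by
  filter_upwards [eventually_axis e.jet_fderiv_surface, eventually_axis D.fderiv_surface]
    with t hjet hsurf
  simpa [hsurf, DevCurve.tangent_apply_zero, DevCurve.second_apply_zero] using
    congrFun (hjet (1, 0)) 0

theorem hasDerivAt_source_axis_fst : HasDerivAt (fun t => (e.source (t, 0)).1)
    (fderiv ℝ e.source (t₀, 0) (1, 0)).1 t₀ := by
  rw [← e.deriv_source_axis.self_of_nhds]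
  exact e.smoothNear_source_axis.differentiableAt.hasDerivAt.fst

theorem hasDerivAt_source_axis_snd : HasDerivAt (fun t => (e.source (t, 0)).2)
    (fderiv ℝ e.source (t₀, 0) (1, 0)).2 t₀ := by
  rw [← e.deriv_source_axis.self_of_nhds]
  exact e.smoothNear_source_axis.differentiableAt.hasDerivAt.snd

theorem source_axis_snd_mul : ∀ᶠ t in 𝓝 t₀,
    (e.source (t, 0)).2 * deriv D'.h₂ (e.source (t, 0)).1 = 0 := by
  have hspeed := eventually_axis (e.smoothNear_speed.continuousAt.eventually_ne e.speed_ne_zero)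
  filter_upwards [eventually_axis e.mul_secondFactor, hspeed] with t hmul hne
  simpa [hne] using hmul.symm

theorem source_axis_snd_eq_zero (hD' : D'.HasOrders a' b' d')
    (hs : (fderiv ℝ e.source (t₀, 0) (1, 0)).1 ≠ 0) : ∀ᶠ t in 𝓝 t₀, (e.source (t, 0)).2 = 0 := by
  have hne := eventually_nhdsWithin_iff.1 (e.hasDerivAt_source_axis_fst.eventually_ne hs (c := t₀'))
  filter_upwards [hne, e.source_axis_snd_mul, eventually_axis (e.source.tendsto.eventually
    (eventually_fst hD'.order_h₂.eventually_ne_zero 0))] with t hfst hmul hh₂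
  rcases eq_or_ne t t₀ with rfl | ht
  · rw [e.source.map_base]
  · exact (mul_eq_zero.1 hmul).resolve_right (hh₂ (hfst ht))

theorem orders_eq_of_transverse (hD : D.HasOrders a b d) (hD' : D'.HasOrders a' b' d')
    (hs : (fderiv ℝ e.source (t₀, 0) (1, 0)).1 ≠ 0) : a = a' ∧ d = d' := by
  have hbase : (e.source (t₀, 0)).1 = t₀' := by rw [e.source.map_base]
  have continuousAt_axis {f : ℝ × ℝ → ℝ} (hf : SmoothNear f (t₀, 0)) :
      ContinuousAt (fun t => f (t, 0)) t₀ :=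
    ContinuousAt.comp (f := fun t => (t, (0 : ℝ))) hf.continuousAt
      (Continuous.prodMk_left (0 : ℝ)).continuousAt
  have hvelocity : ∀ᶠ t in 𝓝 t₀, deriv D.c₁ t * e.jet (t, 0) (D.tangent t) 0 =
      deriv D'.c₁ (e.source (t, 0)).1 * (fderiv ℝ e.source (t, 0) (1, 0)).1 := by
    filter_upwards [e.mul_jet_tangent, e.deriv_source_axis, e.smoothNear_source_axis.eventually,
      (e.source_axis_snd_eq_zero hD' hs).eventually_nhds] with t hmul hderiv hσ hsnd
    have hσ_snd : HasDerivAt (fun t => (e.source (t, 0)).2)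
        (deriv (fun t => e.source (t, 0)) t).2 t := hσ.differentiableAt.hasDerivAt.snd
    have hconst : HasDerivAt (fun t => (e.source (t, 0)).2) 0 t :=
      (hasDerivAt_const t 0).congr_of_eventuallyEq hsnd
    rw [hmul, ← hderiv, hσ_snd.unique hconst, add_zero, mul_comm]
  constructor
  · exact hD.order_c₁.eq_of_comp e.hasDerivAt_source_axis_fst hs
      (by rw [hbase]; exact hD'.order_c₁)
      (continuousAt_axis (f := fun z => e.jet z (D.tangent z.1) 0) (((e.smoothNear_jet
        D.smoothNear_surface).clm_apply (.comp_fst D.smoothNear_tangent)).apply 0))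
      e.jet_tangent_apply_zero_ne_zero
      (continuousAt_axis (e.source.smooth.fderiv.clm_apply (smoothNear_const (1, 0) _)).fst)
      hs hvelocity
  · exact hD.order_k.eq_of_comp e.hasDerivAt_source_axis_fst hs
      (by rw [hbase]; exact hD'.order_k)
      (continuousAt_axis e.smoothNear_conormalFactor) (e.conormalFactor_ne_zero hD)
      (continuousAt_axis (e.smoothNear_speed.mul e.smoothNear_secondFactor))
      (mul_ne_zero e.speed_ne_zero (e.secondFactor_ne_zero hD)) (e.mul_conormalFactor hD)

/-- Here the curve is exchanged, to first order, with the ruling through the base point. -/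
theorem orders_eq_of_not_transverse (hD : D.HasOrders a b d) (hD' : D'.HasOrders a' b' d')
    (hs : (fderiv ℝ e.source (t₀, 0) (1, 0)).1 = 0) : a = 0 ∧ d = d' := by
  have hsnd : (fderiv ℝ e.source (t₀, 0) (1, 0)).2 ≠ 0 := fun hsnd => by
    have hker := e.source.fderiv_injective ((Prod.ext hs hsnd).trans (map_zero _).symm)
    exact one_ne_zero (congrArg Prod.fst hker)
  have ha : a = 0 := by
    refine hD.order_c₁.eq_zero_of_apply_ne_zero fun hzero => hsnd ?_
    simpa [hzero, hs] using e.mul_jet_tangent.self_of_nhds.symm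
  have hne := eventually_nhdsWithin_iff.1 (e.hasDerivAt_source_axis_snd.eventually_ne hsnd (c := 0))
  have hfactor := eventually_axis (e.smoothNear_conormalFactor.continuousAt.eventually_ne
    (e.conormalFactor_ne_zero hD))
  have hk : ∀ᶠ _ in 𝓝[≠] t₀, deriv D'.k t₀' ≠ 0 := eventually_nhdsWithin_iff.2 <| by
    filter_upwards [hne, e.source_axis_snd_mul, eventually_axis (e.source.tendsto.eventually
      (eventually_fst hD'.order_h₂.eventually_ne_zero 0)), e.mul_conormalFactor hD,
      hD.order_k.eventually_ne_zero, hfactor] with t hsnd hmul hh₂ hconormal hk hfactor ht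
    have hfst : (e.source (t, 0)).1 = t₀' :=
      by_contra fun hfst => hh₂ hfst ((mul_eq_zero.1 hmul).resolve_left (hsnd ht))
    rw [hfst] at hconormal
    exact left_ne_zero_of_mul (hconormal ▸ mul_ne_zero (hk ht) hfactor)
  obtain ⟨_, hk'⟩ := hk.exists
  have hk₀ : deriv D.k t₀ ≠ 0 := by
    have hbase := (e.mul_conormalFactor hD).self_of_nhds
    rw [e.source.map_base] at hbase
    exact left_ne_zero_of_mul (hbase ▸ mul_ne_zero hk'
      (mul_ne_zero e.speed_ne_zero (e.secondFactor_ne_zero hD)))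
  exact ⟨ha, (hD.order_k.eq_zero_of_apply_ne_zero hk₀).trans
    (hD'.order_k.eq_zero_of_apply_ne_zero hk').symm⟩

theorem orders_eq (e : GermEquiv D.surface (t₀, 0) D'.surface (t₀', 0))
    (hD : D.HasOrders a b d) (hD' : D'.HasOrders a' b' d') : a = a' ∧ b = b' ∧ d = d' := by
  have half {s s' : ℝ} {C : DevCurve s} {C' : DevCurve s'} {a b d a' b' d' : ℕ}
      (e : GermEquiv C.surface (s, 0) C'.surface (s', 0)) (hC : C.HasOrders a b d)
      (hC' : C'.HasOrders a' b' d') : (a = a' ∨ a = 0) ∧ b' ≤ b ∧ d = d' := by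
    rcases eq_or_ne (fderiv ℝ e.source (s, 0) (1, 0)).1 0 with hs | hs
    · obtain ⟨ha, hd⟩ := e.orders_eq_of_not_transverse hC hC' hs
      exact ⟨.inr ha, e.order_h₂_le hC hC', hd⟩
    · obtain ⟨ha, hd⟩ := e.orders_eq_of_transverse hC hC' hs
      exact ⟨.inl ha, e.order_h₂_le hC hC', hd⟩
  obtain ⟨ha, hb, hd⟩ := half e hD hD'
  obtain ⟨ha', hb', -⟩ := half (e.symm D.smoothNear_surface.continuousAt) hD' hD
  omega

end GermEquiv

/-! ### Echelon families -/

section Echelon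

variable {K V : Type*} [Field K] [AddCommGroup V] [Module K V] {n : ℕ}

/-- The indices at which the span of the initial segments of `v` jumps. -/
def pivots (K : Type*) {V : Type*} [Field K] [AddCommGroup V] [Module K V] (v : ℕ → V) : Set ℕ :=
  {j | v j ∉ Submodule.span K (v '' Set.Iio j)}

theorem mem_span_image_pivots (v : ℕ → V) (j : ℕ) :
    v j ∈ Submodule.span K (v '' (pivots K v ∩ Set.Iic j)) := by
  induction j using Nat.strong_induction_on with
  | _ j ih =>
    by_cases hj : j ∈ pivots K v
    · exact Submodule.subset_span ⟨j, ⟨hj, Set.self_mem_Iic⟩, rfl⟩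
    · refine Submodule.span_le.2 ?_ (not_not.1 hj)
      rintro _ ⟨i, hi, rfl⟩
      have hi' : Set.Iic i ⊆ Set.Iic j := Set.Iic_subset_Iic.2 (le_of_lt hi)
      exact Submodule.span_mono (Set.image_mono (Set.inter_subset_inter_right _ hi')) (ih i hi)

theorem linearIndepOn_pivots (v : ℕ → V) : LinearIndepOn K v (pivots K v) := by
  refine linearIndepOn_iff_linearIndepOn_finset.2 fun s => ?_
  induction s using Finset.induction_on_max with
  | empty => simp
  | insert j s hs ih =>
    intro hjs
    rw [Finset.coe_insert, Set.insert_subset_iff] at hjs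
    rw [Finset.coe_insert]
    exact (ih hjs.2).insert fun hmem =>
      hjs.1 (Submodule.span_mono (Set.image_mono fun i hi => hs i hi) hmem)

/-- In the linear coordinates `L` the vectors `v 0, v 1, …` form a matrix in echelon form whose
row `i` has its first nonzero entry in column `k i`. -/
structure IsEchelon (v : ℕ → V) (k : Fin n → ℕ) (L : V ≃ₗ[K] Fin n → K) : Prop where
  strictMono : StrictMono k
  apply_eq_zero : ∀ i, ∀ j < k i, L (v j) i = 0
  apply_pivot_ne_zero : ∀ i, L (v (k i)) i ≠ 0

theorem exists_isEchelon [Module.Finite K V] {v : ℕ → V} (hn : Module.finrank K V = n)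
    (hv : Submodule.span K (Set.range v) = ⊤) :
    ∃ (k : Fin n → ℕ) (L : V ≃ₗ[K] Fin n → K), IsEchelon v k L := by
  let P := pivots K v
  have hspan : ⊤ ≤ Submodule.span K (Set.range fun j : P => v j) := by
    rw [← hv, Submodule.span_le, ← Set.image_eq_range]
    rintro _ ⟨j, rfl⟩
    exact Submodule.span_mono (Set.image_mono Set.inter_subset_left) (mem_span_image_pivots v j)
  let b : Module.Basis P K V := .mk (linearIndepOn_pivots v) hspan
  have hb (j : P) : b j = v j := Module.Basis.mk_apply _ _ j
  have : Finite P := Module.Finite.finite_basis b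
  have : Fintype P := .ofFinite P
  let e : Fin n ≃o P := Fintype.orderIsoFinOfCardEq P (Module.finrank_eq_card_basis b ▸ hn)
  refine ⟨fun i => e i, (b.reindex e.toEquiv.symm).equivFun, e.strictMono, fun i j hj => ?_,
    fun i => ?_⟩
  · have hmem : v j ∈ Submodule.span K (b '' {p | (p : ℕ) ≤ j}) := by
      refine Submodule.span_mono ?_ (mem_span_image_pivots v j)
      rintro _ ⟨p, ⟨hp, hpj⟩, rfl⟩
      exact ⟨⟨p, hp⟩, hpj, hb _⟩
    have hnot : e i ∉ (b.repr (v j)).support := fun h =>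
      hj.not_ge (b.mem_span_image.1 hmem h)
    rw [Module.Basis.equivFun_apply, Module.Basis.repr_reindex_apply]
    exact Finsupp.notMem_support_iff.1 hnot
  · simp [← hb]

namespace IsEchelon

variable {v : ℕ → V} {k : Fin n → ℕ} {L : V ≃ₗ[K] Fin n → K}

theorem linearIndependent (h : IsEchelon v k L) : LinearIndependent K fun i => v (k i) := by
  let M : Matrix (Fin n) (Fin n) K := .of fun i j => L (v (k i)) j
  have htriangular : M.IsLowerTriangular := fun i j hij => h.apply_eq_zero j _ (h.strictMono hij)
  have hdet : M.det ≠ 0 := by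
    rw [M.det_of_isLowerTriangular htriangular]
    exact Finset.prod_ne_zero_iff.2 fun i _ => h.apply_pivot_ne_zero i
  exact .of_comp (L : V →ₗ[K] Fin n → K) (Matrix.linearIndependent_rows_of_det_ne_zero hdet)

theorem apply_eq_zero_of_mem_span (h : IsEchelon v k L) {r : ℕ} {x : V}
    (hx : x ∈ Submodule.span K (Set.range fun j : Fin r => v j)) {i : Fin n} (hi : r ≤ k i) :
    L x i = 0 := by
  refine Submodule.span_le (p := LinearMap.ker (LinearMap.proj i ∘ₗ L.toLinearMap)).2 ?_ hx
  rintro _ ⟨j, rfl⟩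
  exact h.apply_eq_zero i j (j.2.trans_le hi)

theorem finrank_span (h : IsEchelon v k L) (r : ℕ) :
    Module.finrank K (Submodule.span K (Set.range fun j : Fin r => v j)) =
      Fintype.card {i // k i < r} := by
  set S := Submodule.span K (Set.range fun j : Fin r => v j)
  have : Module.Finite K V := .equiv L.symm
  apply le_antisymm
  · let f : S →ₗ[K] {i // k i < r} → K :=
      LinearMap.funLeft K K Subtype.val ∘ₗ L.toLinearMap ∘ₗ S.subtype
    have hf : Function.Injective f := by
      refine (injective_iff_map_eq_zero f).2 fun x hx => Subtype.ext (L.map_eq_zero_iff.1 ?_)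
      ext i
      by_cases hi : k i < r
      · exact congrFun hx ⟨i, hi⟩
      · exact h.apply_eq_zero_of_mem_span x.2 (not_lt.1 hi)
    simpa using LinearMap.finrank_le_finrank_of_injective hf
  · rw [← finrank_span_eq_card (h.linearIndependent.comp _ Subtype.val_injective)]
    refine Submodule.finrank_mono (Submodule.span_mono ?_)
    rintro _ ⟨i, rfl⟩
    exact ⟨⟨k i, i.2⟩, rfl⟩

theorem eq_zero_of_dotProduct_eq_zero (h : IsEchelon v k L) {r : ℕ} {η : Fin n → K}
    (hη : ∀ j < r, L (v j) ⬝ᵥ η = 0) {i : Fin n} (hi : k i < r) : η i = 0 := by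
  induction i using WellFoundedLT.induction with
  | _ i ih =>
    have hsum : L (v (k i)) ⬝ᵥ η = L (v (k i)) i * η i := by
      refine Finset.sum_eq_single i (fun i' _ hne => ?_) (by simp)
      rcases hne.lt_or_gt with hlt | hgt
      · rw [ih i' hlt ((h.strictMono hlt).trans hi), mul_zero]
      · rw [h.apply_eq_zero i' _ (h.strictMono hgt), zero_mul]
    exact (mul_eq_zero.1 (hsum ▸ hη _ hi)).resolve_left (h.apply_pivot_ne_zero i)

end IsEchelon

end Echelon

/-! ### Lifts and affine coordinates -/

theorem HasCoords.exists_rep {p : RP3} {x : V4} (h : HasCoords p x) :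
    ∃ a : ℝ, a ≠ 0 ∧ p.rep = a • x := by
  obtain ⟨h0, rfl⟩ := h
  obtain ⟨a, ha⟩ := Projectivization.exists_smul_eq_mk_rep ℝ x h0
  exact ⟨a, a.ne_zero, ha.symm⟩

theorem HasCoords.inChart_iff {p : RP3} {x : V4} (h : HasCoords p x) (A : V4 ≃ₗ[ℝ] V4) :
    InChart A p ↔ A x 0 ≠ 0 := by
  obtain ⟨a, ha, hrep⟩ := h.exists_rep
  simp [InChart, hrep, ha]

theorem HasCoords.affCoord_eq {p : RP3} {x : V4} (h : HasCoords p x) (A : V4 ≃ₗ[ℝ] V4) :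
    affCoord A p = fun i => A x i.succ / A x 0 := by
  obtain ⟨a, ha, hrep⟩ := h.exists_rep
  ext i
  simp [affCoord, hrep, mul_div_mul_left _ _ ha]

theorem exists_inChart (p : RP3) : ∃ A : V4 ≃ₗ[ℝ] V4, InChart A p := by
  obtain ⟨i, hi⟩ := Function.ne_iff.1 p.rep_nonzero
  exact ⟨LinearEquiv.funCongrLeft ℝ ℝ (Equiv.swap 0 i), by
    simpa [InChart, LinearEquiv.funCongrLeft_apply, LinearMap.funLeft_apply] using hi⟩

theorem vecCons_one_div {x : V4} (h : x 0 ≠ 0) :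
    (Matrix.vecCons 1 fun i => x i.succ / x 0 : V4) = (x 0)⁻¹ • x := by
  ext i
  refine Fin.cases ?_ (fun i => ?_) i
  · simp [h]
  · simp [div_eq_inv_mul]

namespace IsLift

variable {γ : ℝ → RP3} {t₀ : ℝ} {X : ℝ → V4} {A : V4 ≃ₗ[ℝ] V4}

theorem chart_ne_zero (hX : IsLift γ t₀ X) (hA : InChart A (γ t₀)) : A (X t₀) 0 ≠ 0 :=
  (hX.2.self_of_nhds.inChart_iff A).1 hA

theorem smoothNear_chart (hX : IsLift γ t₀ X) (A : V4 ≃ₗ[ℝ] V4) (i : Fin 4) :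
    SmoothNear (fun t => A (X t) i) t₀ :=
  (hX.1.linearMap_comp A.toLinearMap).apply i

theorem affCoord_eventuallyEq (hX : IsLift γ t₀ X) (A : V4 ≃ₗ[ℝ] V4) :
    affCoord A ∘ γ =ᶠ[𝓝 t₀] fun t i => A (X t) i.succ / A (X t) 0 := by
  filter_upwards [hX.2] with t ht using ht.affCoord_eq A

theorem smoothNear_affCoord (hX : IsLift γ t₀ X) (hA : InChart A (γ t₀)) :
    SmoothNear (affCoord A ∘ γ) t₀ :=
  .congr (.pi fun i => (hX.smoothNear_chart A i.succ).div (hX.smoothNear_chart A 0)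
    (hX.chart_ne_zero hA)) (hX.affCoord_eventuallyEq A)

theorem vecCons_affCoord (hX : IsLift γ t₀ X) (hA : InChart A (γ t₀)) :
    ∀ᶠ t in 𝓝 t₀, Matrix.vecCons 1 (affCoord A (γ t)) = (A (X t) 0)⁻¹ • A (X t) := by
  filter_upwards [hX.2, (hX.smoothNear_chart A 0).continuousAt.eventually_ne
    (hX.chart_ne_zero hA)] with t ht h0
  rw [ht.affCoord_eq A, vecCons_one_div h0]

end IsLift

/-! ### Adapted coordinates of a curve -/

section Iterated

variable {F G : Type} [NormedAddCommGroup F] [NormedSpace ℝ F] [FiniteDimensional ℝ F]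
  [NormedAddCommGroup G] [NormedSpace ℝ G]

theorem SmoothNear.iteratedDeriv_linearMap_comp {f : ℝ → F} {t₀ : ℝ} (hf : SmoothNear f t₀)
    (L : F →ₗ[ℝ] G) (n : ℕ) :
    _root_.iteratedDeriv n (fun t => L (f t)) t₀ = L (_root_.iteratedDeriv n f t₀) := by
  have h := L.toContinuousLinearMap.iteratedFDeriv_comp_left hf.contDiffAt
    (i := n) (mod_cast le_top)
  simp only [iteratedDeriv_eq_iteratedFDeriv]
  exact congrArg (fun T => T fun _ => 1) h

variable {n : ℕ} {X : ℝ → F} {t₀ : ℝ} {k : Fin n → ℕ} {L : F ≃ₗ[ℝ] Fin n → ℝ}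

theorem isEchelon_iteratedDeriv_iff (hX : SmoothNear X t₀) :
    IsEchelon (fun j => iteratedDeriv j X t₀) k L ↔
      StrictMono k ∧ ∀ i, HasOrder (fun t => L (X t) i) t₀ (k i) := by
  have hcoord (i : Fin n) (j : ℕ) :
      iteratedDeriv j (fun t => L (X t) i) t₀ = L (iteratedDeriv j X t₀) i :=
    hX.iteratedDeriv_linearMap_comp (LinearMap.proj i ∘ₗ L.toLinearMap) j
  constructor
  · intro h
    refine ⟨h.strictMono, fun i => .of_iteratedDeriv ((hX.linearMap_comp L.toLinearMap).apply i)
      (fun j hj => ?_) ?_⟩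
    · rw [hcoord, h.apply_eq_zero i j hj]
    · rw [hcoord]; exact h.apply_pivot_ne_zero i
  · rintro ⟨hk, hord⟩
    refine ⟨hk, fun i j hj => ?_, fun i => ?_⟩
    · rw [← hcoord, (hord i).iteratedDeriv_eq_zero hj]
    · rw [← hcoord]; exact (hord i).iteratedDeriv_ne_zero

theorem IsEchelon.of_eventually_eq_smul {F' : Type} [NormedAddCommGroup F'] [NormedSpace ℝ F']
    [FiniteDimensional ℝ F'] {Y : ℝ → F'} {L' : F' ≃ₗ[ℝ] Fin n → ℝ} {u : ℝ → ℝ}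
    (hX : SmoothNear X t₀) (hY : SmoothNear Y t₀) (hu : SmoothNear u t₀) (hu0 : u t₀ ≠ 0)
    (h : IsEchelon (fun j => iteratedDeriv j X t₀) k L)
    (hXY : ∀ᶠ t in 𝓝 t₀, L' (Y t) = u t • L (X t)) :
    IsEchelon (fun j => iteratedDeriv j Y t₀) k L' := by
  obtain ⟨hk, hord⟩ := (isEchelon_iteratedDeriv_iff hX).1 h
  refine (isEchelon_iteratedDeriv_iff hY).2 ⟨hk, fun i => ?_⟩
  have hprod := (HasOrder.of_apply_ne_zero hu hu0).mul (hord i)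
  rw [zero_add] at hprod
  refine hprod.congr ?_
  filter_upwards [hXY] with t ht
  simp [ht]

end Iterated

theorem finrank_span_insert_vecCons (y : E3) (S : Set E3) :
    Module.finrank ℝ (Submodule.span ℝ
      (insert (Matrix.vecCons 1 y) (Matrix.vecCons 0 '' S) : Set V4)) =
      Module.finrank ℝ (Submodule.span ℝ S) + 1 := by
  let ι : E3 →ₗ[ℝ] V4 := LinearMap.vecCons 0 LinearMap.id
  have hι : Function.Injective ι := fun x y h => (Matrix.vecCons_inj.1 h).2
  have hmap : Submodule.span ℝ (Matrix.vecCons 0 '' S : Set V4) =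
      (Submodule.span ℝ S).map ι := (Submodule.map_span ι S).symm
  have hnotMem : (Matrix.vecCons 1 y : V4) ∉ (Submodule.span ℝ S).map ι := by
    rintro ⟨x, -, hx⟩
    exact zero_ne_one (Matrix.vecCons_inj.1 hx).1
  rw [Set.insert_eq, Submodule.span_union, hmap, sup_comm,
    Submodule.finrank_sup_span_singleton hnotMem,
    (Submodule.equivMapOfInjective ι hι _).finrank_eq.symm]

theorem smoothNear_vecCons {E : Type} [NormedAddCommGroup E] [NormedSpace ℝ E] {c : E → E3}
    {x : E} (hc : SmoothNear c x) (s : ℝ) :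
    SmoothNear (fun y => (Matrix.vecCons s (c y) : V4)) x :=
  .pi fun i => Fin.cases (smoothNear_const s x) (fun i => hc.apply i) i

theorem iteratedDeriv_vecCons_succ {c : ℝ → E3} {t₀ : ℝ} (hc : SmoothNear c t₀) (j : ℕ) :
    iteratedDeriv (j + 1) (fun t => (Matrix.vecCons 1 (c t) : V4)) t₀ =
      Matrix.vecCons 0 (iteratedDeriv (j + 1) c t₀) := by
  have hsplit (t : ℝ) : (Matrix.vecCons 1 (c t) : V4) =
      Matrix.vecCons 1 0 + (LinearMap.vecCons 0 LinearMap.id : E3 →ₗ[ℝ] V4) (c t) := by simp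
  simp only [hsplit]
  rw [iteratedDeriv_const_add j.succ_pos, hc.iteratedDeriv_linearMap_comp]
  rfl

theorem range_iteratedDeriv_vecCons {c : ℝ → E3} {t₀ : ℝ} (hc : SmoothNear c t₀) :
    (Set.range fun j => iteratedDeriv j (fun t => (Matrix.vecCons 1 (c t) : V4)) t₀) =
      insert (Matrix.vecCons 1 (c t₀))
        (Matrix.vecCons 0 '' Set.range fun j => iteratedDeriv (j + 1) c t₀) := by
  rw [← Nat.range_of_succ, ← Set.range_comp, ← Set.insert_eq]
  simp only [iteratedDeriv_zero, Function.comp_def, Nat.succ_eq_add_one,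
    iteratedDeriv_vecCons_succ hc]

theorem range_fin_iteratedDeriv_vecCons {c : ℝ → E3} {t₀ : ℝ} (hc : SmoothNear c t₀) (r : ℕ) :
    (Set.range fun j : Fin (r + 1) =>
        iteratedDeriv j (fun t => (Matrix.vecCons 1 (c t) : V4)) t₀) =
      insert (Matrix.vecCons 1 (c t₀))
        (Matrix.vecCons 0 '' Set.range fun j : Fin r => iteratedDeriv (j + 1) c t₀) := by
  rw [Fin.range_fin_succ, ← Set.range_comp]
  simp only [Fin.val_zero, iteratedDeriv_zero, Function.comp_def, Fin.tail_def, Fin.val_succ,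
    iteratedDeriv_vecCons_succ hc]

theorem FiniteType.exists_isEchelon {γ : ℝ → RP3} {t₀ : ℝ} {X : ℝ → V4} (hγ : FiniteType γ t₀)
    (hX : IsLift γ t₀ X) : ∃ (k : Fin 4 → ℕ) (G : V4 ≃ₗ[ℝ] V4),
      IsEchelon (fun j => iteratedDeriv j X t₀) k G := by
  obtain ⟨A, hA⟩ := exists_inChart (γ t₀)
  have hc := hX.smoothNear_affCoord hA
  have hrank := finrank_span_insert_vecCons ((affCoord A ∘ γ) t₀)
    (Set.range fun j => iteratedDeriv (j + 1) (affCoord A ∘ γ) t₀)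
  rw [hγ A hA, ← range_iteratedDeriv_vecCons hc] at hrank
  obtain ⟨k, L, hL⟩ := TangentDev.exists_isEchelon (n := 4) (by simp)
    (Submodule.eq_top_of_finrank_eq (hrank.trans (by simp)))
  refine ⟨k, A.trans L, hL.of_eventually_eq_smul (smoothNear_vecCons hc 1) hX.1
    (hX.smoothNear_chart A 0) (hX.chart_ne_zero hA) ?_⟩
  filter_upwards [hX.vecCons_affCoord hA, (hX.smoothNear_chart A 0).continuousAt.eventually_ne
    (hX.chart_ne_zero hA)] with t ht h0
  simp [ht, h0]

/-- The pivots `(0, a₁, a₂, a₃)` of a lift of a curve of type `(a₁, a₂, a₃)`, where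
`a₁ = a + 1`, `a₂ = a₁ + b + 1` and `a₃ = a₂ + d + 1`. -/
def typeIndices (a b d : ℕ) : Fin 4 → ℕ := ![0, a + 1, a + b + 2, a + b + d + 3]

theorem exists_eq_typeIndices {k : Fin 4 → ℕ} (hk : StrictMono k) (h0 : k 0 = 0) :
    ∃ a b d, k = typeIndices a b d := by
  have h01 : k 0 < k 1 := hk (by decide)
  have h12 : k 1 < k 2 := hk (by decide)
  have h23 : k 2 < k 3 := hk (by decide)
  refine ⟨k 1 - 1, k 2 - k 1 - 1, k 3 - k 2 - 1, funext fun i => ?_⟩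
  fin_cases i <;> simp [typeIndices] <;> omega

theorem card_typeIndices_lt (a b d r : ℕ) :
    Fintype.card {i // typeIndices a b d i < r + 1} =
      1 + (if a + 1 ≤ r then 1 else 0) + (if a + b + 2 ≤ r then 1 else 0) +
        (if a + b + d + 3 ≤ r then 1 else 0) := by
  rw [Fintype.card_subtype, Finset.card_filter, Fin.sum_univ_four]
  simp [typeIndices]

namespace IsLift

variable {γ : ℝ → RP3} {t₀ : ℝ} {X : ℝ → V4} {G : V4 ≃ₗ[ℝ] V4}

theorem exists_isEchelon_typeIndices (hX : IsLift γ t₀ X) (hγ : FiniteType γ t₀) :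
    ∃ (a b d : ℕ) (G : V4 ≃ₗ[ℝ] V4),
      IsEchelon (fun j => iteratedDeriv j X t₀) (typeIndices a b d) G := by
  obtain ⟨k, G, hG⟩ := hγ.exists_isEchelon hX
  have h0 : k 0 = 0 := by
    by_contra h
    obtain ⟨hne, -⟩ := hX.2.self_of_nhds
    refine hne (G.map_eq_zero_iff.1 (funext fun i => ?_))
    simpa using hG.apply_eq_zero i 0
      ((Nat.pos_of_ne_zero h).trans_le (hG.strictMono.monotone (Fin.zero_le i)))
  obtain ⟨a, b, d, rfl⟩ := exists_eq_typeIndices hG.strictMono h0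
  exact ⟨a, b, d, G, hG⟩

variable {a b d : ℕ}

theorem rank_derivMatrix (hX : IsLift γ t₀ X)
    (hG : IsEchelon (fun j => iteratedDeriv j X t₀) (typeIndices a b d) G)
    {A : V4 ≃ₗ[ℝ] V4} (hA : InChart A (γ t₀)) (r : ℕ) :
    (derivMatrix (affCoord A ∘ γ) t₀ r).rank =
      (if a + 1 ≤ r then 1 else 0) + (if a + b + 2 ≤ r then 1 else 0) +
        (if a + b + d + 3 ≤ r then 1 else 0) := by
  have hc := hX.smoothNear_affCoord hA
  have hG' : IsEchelon (fun j => iteratedDeriv j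
      (fun t => (Matrix.vecCons 1 ((affCoord A ∘ γ) t) : V4)) t₀) (typeIndices a b d)
      (A.symm.trans G) := by
    refine hG.of_eventually_eq_smul hX.1 (smoothNear_vecCons hc 1)
      (SmoothNear.div (smoothNear_const 1 _) (hX.smoothNear_chart A 0) (hX.chart_ne_zero hA))
      (by simpa using hX.chart_ne_zero hA) ?_
    filter_upwards [hX.vecCons_affCoord hA] with t ht
    simp [ht]
  have hcols : Set.range (derivMatrix (affCoord A ∘ γ) t₀ r).col =
      Set.range fun j : Fin r => iteratedDeriv (j + 1) (affCoord A ∘ γ) t₀ := rfl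
  have hspan := hG'.finrank_span (r + 1)
  rw [range_fin_iteratedDeriv_vecCons hc, finrank_span_insert_vecCons, ← hcols,
    ← Matrix.rank_eq_finrank_span_cols, card_typeIndices_lt] at hspan
  omega

theorem hasType (hX : IsLift γ t₀ X)
    (hG : IsEchelon (fun j => iteratedDeriv j X t₀) (typeIndices a b d) G) :
    HasType γ t₀ (a + 1) (a + b + 2) (a + b + d + 3) := by
  intro A hA
  simp only [hX.rank_derivMatrix hG hA, IsLeast, lowerBounds, Set.mem_ofPred_eq]
  refine ⟨⟨?_, fun r hr => ?_⟩, ⟨?_, fun r hr => ?_⟩, ⟨?_, fun r hr => ?_⟩⟩ <;>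
    split_ifs at * <;> omega

end IsLift

namespace DevCurve

variable {t₀ : ℝ} (D : DevCurve t₀)

/-- Homogeneous coordinates of the point of the curve at `t`. -/
def homog (t : ℝ) : V4 := Matrix.vecCons 1 (D.curve t)

/-- Homogeneous coordinates of the point at infinity of the tangent line at `t`. -/
def homogTangent (t : ℝ) : V4 := Matrix.vecCons 0 (D.tangent t)

/-- The curve starts at the origin, and its osculating flag there is spanned by the first vectors
of the standard basis. -/
structure IsNormalized : Prop where
  curve_eq : D.curve t₀ = 0
  tangent_eq : D.tangent t₀ = ![1, 0, 0]
  second_eq : D.second t₀ = ![0, 1, 0]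

end DevCurve

theorem exists_devCurve {c : ℝ → E3} {t₀ : ℝ} {a b d : ℕ}
    (h₁ : HasOrder (c · 0) t₀ (a + 1)) (h₂ : HasOrder (c · 1) t₀ (a + b + 2))
    (h₃ : HasOrder (c · 2) t₀ (a + b + d + 3)) :
    ∃ D : DevCurve t₀, D.curve = c ∧ D.HasOrders a b d ∧ D.IsNormalized := by
  obtain ⟨u, hu, deriv_c₂⟩ := HasOrder.exists_quotient (k := a) (l := b + 1)
    (HasOrder.deriv (k := a + (b + 1)) h₂) h₁.deriv
  obtain ⟨v, hv, deriv_c₃⟩ := HasOrder.exists_quotient (k := a) (l := b + d + 2)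
    (HasOrder.deriv (k := a + (b + d + 2))
      (by rwa [show a + (b + d + 2) + 1 = a + b + d + 3 by omega])) h₁.deriv
  obtain ⟨w, hw, deriv_v⟩ := HasOrder.exists_quotient (k := b) (l := d + 1)
    (HasOrder.deriv (k := b + (d + 1)) hv) hu.deriv
  refine ⟨⟨(c · 0), (c · 1), (c · 2), u, v, w, h₁.smoothNear, h₂.smoothNear, h₃.smoothNear,
    hu.smoothNear, hv.smoothNear, hw.smoothNear, deriv_c₂, deriv_c₃, deriv_v⟩, ?_,
    ⟨h₁.deriv, hu.deriv, hw.deriv⟩, ?_, ?_, ?_⟩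
  · ext t i
    fin_cases i <;> rfl
  · ext i
    fin_cases i
    exacts [h₁.apply_eq_zero (by simp), h₂.apply_eq_zero (by simp), h₃.apply_eq_zero (by simp)]
  · simp [DevCurve.tangent, hu.apply_eq_zero, hv.apply_eq_zero]
  · simp [DevCurve.second, hw.apply_eq_zero]

theorem IsEchelon.exists_devCurve {X : ℝ → V4} {t₀ : ℝ} {a b d : ℕ} {G : V4 ≃ₗ[ℝ] V4}
    (hX : SmoothNear X t₀)
    (hG : IsEchelon (fun j => iteratedDeriv j X t₀) (typeIndices a b d) G) :
    G (X t₀) 0 ≠ 0 ∧ ∃ D : DevCurve t₀, D.HasOrders a b d ∧ D.IsNormalized ∧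
      ∀ᶠ t in 𝓝 t₀, G (X t) = G (X t) 0 • D.homog t := by
  obtain ⟨-, hord⟩ := (isEchelon_iteratedDeriv_iff hX).1 hG
  have h0 : G (X t₀) 0 ≠ 0 := (hord 0).apply_ne_zero
  have hinv : HasOrder (fun t => (G (X t) 0)⁻¹) t₀ 0 :=
    .of_apply_ne_zero (by simpa using (smoothNear_const 1 t₀).div (hord 0).smoothNear h0)
      (inv_ne_zero h0)
  have hquot (i : Fin 3) :
      HasOrder (fun t => G (X t) i.succ / G (X t) 0) t₀ (typeIndices a b d i.succ) := by
    simpa only [div_eq_mul_inv, add_zero] using (hord i.succ).mul hinv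
  obtain ⟨D, hcurve, hD, hnorm⟩ := TangentDev.exists_devCurve
    (c := fun t i => G (X t) i.succ / G (X t) 0) (hquot 0) (hquot 1) (hquot 2)
  refine ⟨h0, D, hD, hnorm, ?_⟩
  filter_upwards [(hord 0).smoothNear.continuousAt.eventually_ne h0] with t ht
  rw [DevCurve.homog, hcurve, vecCons_one_div ht, smul_inv_smul₀ ht]

/-! ### Projective maps and ruled surfaces -/

/-- The projective transformation given by `H`, in the standard affine chart `y ↦ [1 : y]`. -/
def projMap (H : V4 ≃ₗ[ℝ] V4) (y : E3) : E3 := fun i =>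
  H (Matrix.vecCons 1 y) i.succ / H (Matrix.vecCons 1 y) 0

theorem vecCons_projMap {H : V4 ≃ₗ[ℝ] V4} {y : E3} (h : H (Matrix.vecCons 1 y) 0 ≠ 0) :
    Matrix.vecCons 1 (projMap H y) = (H (Matrix.vecCons 1 y) 0)⁻¹ • H (Matrix.vecCons 1 y) :=
  vecCons_one_div h

theorem projMap_of_eq_smul {H : V4 ≃ₗ[ℝ] V4} {x y : E3} {s : ℝ} (hs : s ≠ 0)
    (h : H (Matrix.vecCons 1 y) = s • Matrix.vecCons 1 x) : projMap H y = x := by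
  ext i
  simp [projMap, h, hs]

theorem symm_vecCons_projMap {H : V4 ≃ₗ[ℝ] V4} {y : E3} (h : H (Matrix.vecCons 1 y) 0 ≠ 0) :
    H.symm (Matrix.vecCons 1 (projMap H y)) =
      (H (Matrix.vecCons 1 y) 0)⁻¹ • Matrix.vecCons 1 y := by
  rw [vecCons_projMap h, map_smul, H.symm_apply_apply]

theorem projMap_symm_projMap {H : V4 ≃ₗ[ℝ] V4} {y : E3} (h : H (Matrix.vecCons 1 y) 0 ≠ 0) :
    projMap H.symm (projMap H y) = y :=
  projMap_of_eq_smul (inv_ne_zero h) (symm_vecCons_projMap h)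

theorem smoothNear_vecCons_apply (H : V4 ≃ₗ[ℝ] V4) (y : E3) (i : Fin 4) :
    SmoothNear (fun y : E3 => H (Matrix.vecCons 1 y) i) y :=
  ((smoothNear_vecCons (smoothNear_of_contDiff contDiff_id y) 1).linearMap_comp
    H.toLinearMap).apply i

theorem smoothNear_projMap {H : V4 ≃ₗ[ℝ] V4} {y : E3} (h : H (Matrix.vecCons 1 y) 0 ≠ 0) :
    SmoothNear (projMap H) y :=
  .pi fun i => (smoothNear_vecCons_apply H y i.succ).div (smoothNear_vecCons_apply H y 0) h

/-- The diffeomorphism-germ of a projective transformation at a point that it does not send to the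
plane at infinity. -/
def projDiffeoGerm {H : V4 ≃ₗ[ℝ] V4} {x y : E3} (h : H (Matrix.vecCons 1 y) 0 ≠ 0)
    (hx : projMap H y = x) : DiffeoGerm y x :=
  have h' : H.symm (Matrix.vecCons 1 x) 0 ≠ 0 := by
    rw [← hx, symm_vecCons_projMap h]
    simpa using h
  { toFun := projMap H
    invFun := projMap H.symm
    smooth := smoothNear_projMap h
    smooth_inv := smoothNear_projMap h'
    map_base := hx
    inv_base := hx ▸ projMap_symm_projMap h
    left_inv := by
      filter_upwards [(smoothNear_vecCons_apply H y 0).continuousAt.eventually_ne h] with z hz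
        using projMap_symm_projMap hz
    right_inv := by
      filter_upwards [(smoothNear_vecCons_apply H.symm x 0).continuousAt.eventually_ne h']
        with z hz using projMap_symm_projMap (H := H.symm) hz }

theorem HasCoords.affCoord_eq_projMap {p : RP3} {x : V4} {H : V4 ≃ₗ[ℝ] V4} {y : E3} {s : ℝ}
    (h : HasCoords p x) (hx : H x = s • Matrix.vecCons 1 y) (A : V4 ≃ₗ[ℝ] V4) :
    affCoord A p = projMap (H.symm.trans A) y := by
  have hAx : A x = s • H.symm.trans A (Matrix.vecCons 1 y) := by
    rw [← map_smul, ← hx, LinearEquiv.trans_apply, H.symm_apply_apply]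
  have hs : s ≠ 0 := by
    rintro rfl
    exact h.1 (by simpa using hx)
  ext i
  simp [h.affCoord_eq A, hAx, projMap, mul_div_mul_left _ _ hs]

theorem HasCoords.projMap_denom_ne_zero {p : RP3} {x : V4} {H A : V4 ≃ₗ[ℝ] V4} {y : E3} {s : ℝ}
    (h : HasCoords p x) (hx : H x = s • Matrix.vecCons 1 y) (hA : InChart A p) :
    H.symm.trans A (Matrix.vecCons 1 y) 0 ≠ 0 := by
  have hAx : A x = s • H.symm.trans A (Matrix.vecCons 1 y) := by
    rw [← map_smul, ← hx, LinearEquiv.trans_apply, H.symm_apply_apply]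
  have hne := (h.inChart_iff A).1 hA
  rw [hAx] at hne
  exact right_ne_zero_of_mul hne

section Mobius

variable {r s p q : ℝ → ℝ} {t₀ : ℝ}

/-- The Möbius transformation of the second coordinate whose coefficients are functions of the
first coordinate. -/
def fibreMobius (r s p q : ℝ → ℝ) (z : ℝ × ℝ) : ℝ × ℝ :=
  (z.1, (p z.1 + z.2 * q z.1) / (r z.1 + z.2 * s z.1))

theorem fibreMobius_fibreMobius {z : ℝ × ℝ} (hz : r z.1 + z.2 * s z.1 ≠ 0)
    (hdet : q z.1 * r z.1 - p z.1 * s z.1 ≠ 0) :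
    fibreMobius q (-s) (-p) r (fibreMobius r s p q z) = z := by
  refine Prod.ext rfl ?_
  have hdenom : q z.1 + (p z.1 + z.2 * q z.1) / (r z.1 + z.2 * s z.1) * -s z.1 =
      (q z.1 * r z.1 - p z.1 * s z.1) / (r z.1 + z.2 * s z.1) := by
    field_simp
    ring
  simp only [fibreMobius, Pi.neg_apply, hdenom]
  field_simp
  ring

theorem smoothNear_fibreMobius_denom (hr : SmoothNear r t₀) (hs : SmoothNear s t₀) :
    SmoothNear (fun z : ℝ × ℝ => r z.1 + z.2 * s z.1) (t₀, 0) :=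
  (SmoothNear.comp_fst hr).add
    (SmoothNear.mul (smoothNear_of_contDiff contDiff_snd _) (.comp_fst hs))

theorem smoothNear_fibreMobius (hr : SmoothNear r t₀) (hs : SmoothNear s t₀)
    (hp : SmoothNear p t₀) (hq : SmoothNear q t₀) (hr0 : r t₀ ≠ 0) :
    SmoothNear (fibreMobius r s p q) (t₀, 0) :=
  (smoothNear_of_contDiff contDiff_fst _).prodMk ((smoothNear_fibreMobius_denom hp hq).div
    (smoothNear_fibreMobius_denom hr hs) (by simpa using hr0))

theorem fibreMobius_leftInverse (hr : SmoothNear r t₀) (hs : SmoothNear s t₀)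
    (hp : SmoothNear p t₀) (hq : SmoothNear q t₀) (hr0 : r t₀ ≠ 0) (hp0 : p t₀ = 0)
    (hq0 : q t₀ ≠ 0) :
    ∀ᶠ z in 𝓝 (t₀, (0 : ℝ)), fibreMobius q (-s) (-p) r (fibreMobius r s p q z) = z := by
  have hdet : SmoothNear (fun t => q t * r t - p t * s t) t₀ := (hq.mul hr).sub (hp.mul hs)
  filter_upwards [(smoothNear_fibreMobius_denom hr hs).continuousAt.eventually_ne
    (y := 0) (by simpa using hr0),
    eventually_fst (hdet.continuousAt.eventually_ne (y := 0) (by simp [hp0, hq0, hr0])) 0]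
    with z hz hz' using fibreMobius_fibreMobius hz hz'

/-- The diffeomorphism-germ of the plane induced by a family of Möbius transformations of the
second coordinate, the one over `t₀` fixing the origin. -/
def fibreMobiusGerm (hr : SmoothNear r t₀) (hs : SmoothNear s t₀) (hp : SmoothNear p t₀)
    (hq : SmoothNear q t₀) (hr0 : r t₀ ≠ 0) (hp0 : p t₀ = 0) (hq0 : q t₀ ≠ 0) :
    DiffeoGerm (t₀, (0 : ℝ)) (t₀, (0 : ℝ)) where
  toFun := fibreMobius r s p q
  invFun := fibreMobius q (-s) (-p) r
  smooth := smoothNear_fibreMobius hr hs hp hq hr0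
  smooth_inv := smoothNear_fibreMobius hq hs.neg hp.neg hr hq0
  map_base := by simp [fibreMobius, hp0]
  inv_base := by simp [fibreMobius, hp0]
  left_inv := fibreMobius_leftInverse hr hs hp hq hr0 hp0 hq0
  right_inv := by
    simpa only [neg_neg] using
      fibreMobius_leftInverse (s := -s) (p := -p) hq hs.neg hp.neg hr hq0 (neg_eq_zero.2 hp0) hr0

end Mobius

theorem linearIndependent_pair_map {K V V' : Type*} [Semiring K] [AddCommMonoid V]
    [AddCommMonoid V'] [Module K V] [Module K V'] (H : V ≃ₗ[K] V') {v w : V}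
    (h : LinearIndependent K ![v, w]) : LinearIndependent K ![H v, H w] := by
  rw [LinearIndependent.pair_iffₛ] at h ⊢
  intro a b c d hab
  exact h a b c d (H.injective (by simpa using hab))

namespace DevCurve

variable {t₀ : ℝ} (D : DevCurve t₀)

/-- The tangent line at `t`, as a plane through the origin of the space of homogeneous
coordinates. -/
def tangentSpan (t : ℝ) : Submodule ℝ V4 := Submodule.span ℝ {D.homog t, D.homogTangent t}

theorem mem_tangentSpan_iff {t : ℝ} {v : V4} :
    v ∈ D.tangentSpan t ↔
      v = v 0 • D.homog t + (v 1 - v 0 * D.c₁ t) • D.homogTangent t := by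
  refine ⟨fun h => ?_, fun h => Submodule.mem_span_pair.2 ⟨_, _, h.symm⟩⟩
  obtain ⟨x, y, rfl⟩ := Submodule.mem_span_pair.1 h
  simp [homog, homogTangent, curve, tangent]

theorem vecCons_surface (z : ℝ × ℝ) :
    Matrix.vecCons 1 (D.surface z) = D.homog z.1 + z.2 • D.homogTangent z.1 := by
  simp [surface, homog, homogTangent]

theorem smul_vecCons_surface_fibreMobius {r s p q : ℝ → ℝ} {z : ℝ × ℝ}
    (hz : r z.1 + z.2 * s z.1 ≠ 0) :
    (r z.1 + z.2 * s z.1) • Matrix.vecCons 1 (D.surface (fibreMobius r s p q z)) =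
      (r z.1 • D.homog z.1 + p z.1 • D.homogTangent z.1) +
        z.2 • (s z.1 • D.homog z.1 + q z.1 • D.homogTangent z.1) := by
  rw [vecCons_surface, fibreMobius, smul_add, smul_smul, mul_div_cancel₀ _ hz]
  module

theorem coeffs_of_linearIndependent {t : ℝ} {v w : V4} (h : LinearIndependent ℝ ![v, w])
    (hv : v ∈ Submodule.span ℝ {D.homog t}) (hw : w ∈ D.tangentSpan t) :
    v 0 ≠ 0 ∧ v 1 - v 0 * D.c₁ t = 0 ∧ w 1 - w 0 * D.c₁ t ≠ 0 := by
  obtain ⟨x, rfl⟩ := Submodule.mem_span_singleton.1 hv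
  obtain ⟨y, z, rfl⟩ := Submodule.mem_span_pair.1 hw
  have hx : x ≠ 0 := by
    rintro rfl
    exact h.ne_zero 0 (by simp)
  have hz : z ≠ 0 := by
    rintro rfl
    exact hx (neg_eq_zero.1 (LinearIndependent.pair_iff.1 h y (-x) (by module)).2)
  simpa [homog, homogTangent, curve, tangent] using ⟨hx, hz⟩

theorem nonempty_germEquiv_of_ruled {R S : ℝ → V4} {F : ℝ × ℝ → RP3} {A H : V4 ≃ₗ[ℝ] V4}
    (hR : SmoothNear R t₀) (hS : SmoothNear S t₀) (hindep : LinearIndependent ℝ ![R t₀, S t₀])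
    (hRmem : ∀ᶠ t in 𝓝 t₀, H (R t) ∈ D.tangentSpan t)
    (hSmem : ∀ᶠ t in 𝓝 t₀, H (S t) ∈ D.tangentSpan t)
    (hbase : H (R t₀) ∈ Submodule.span ℝ {D.homog t₀})
    (hF : ∀ᶠ z in 𝓝 (t₀, (0 : ℝ)), HasCoords (F z) (R z.1 + z.2 • S z.1))
    (hA : InChart A (F (t₀, 0))) :
    Nonempty (GermEquiv D.surface (t₀, 0) (affCoord A ∘ F) (t₀, 0)) := by
  let r t := H (R t) 0
  let s t := H (S t) 0
  let p t := H (R t) 1 - r t * D.c₁ t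
  let q t := H (S t) 1 - s t * D.c₁ t
  have smooth_apply {V : ℝ → V4} (hV : SmoothNear V t₀) (i : Fin 4) :
      SmoothNear (fun t => H (V t) i) t₀ := (hV.linearMap_comp H.toLinearMap).apply i
  have hr : SmoothNear r t₀ := smooth_apply hR 0
  have hs : SmoothNear s t₀ := smooth_apply hS 0
  have hp : SmoothNear p t₀ := (smooth_apply hR 1).sub (hr.mul D.smooth_c₁)
  have hq : SmoothNear q t₀ := (smooth_apply hS 1).sub (hs.mul D.smooth_c₁)
  obtain ⟨hr0, hp0, hq0⟩ : r t₀ ≠ 0 ∧ p t₀ = 0 ∧ q t₀ ≠ 0 :=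
    D.coeffs_of_linearIndependent (linearIndependent_pair_map H hindep) hbase hSmem.self_of_nhds
  have hH : ∀ᶠ z in 𝓝 (t₀, (0 : ℝ)), H (R z.1 + z.2 • S z.1) =
      (r z.1 + z.2 * s z.1) • Matrix.vecCons 1 (D.surface (fibreMobius r s p q z)) := by
    filter_upwards [eventually_fst hRmem 0, eventually_fst hSmem 0,
      (smoothNear_fibreMobius_denom hr hs).continuousAt.eventually_ne (y := 0)
        (by simpa using hr0)] with z hRz hSz hz
    rw [D.smul_vecCons_surface_fibreMobius hz, map_add, map_smul]
    exact congrArg₂ (· + z.2 • ·) (D.mem_tangentSpan_iff.1 hRz) (D.mem_tangentSpan_iff.1 hSz)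
  let σ := fibreMobiusGerm hr hs hp hq hr0 hp0 hq0
  have hchart : ∀ᶠ z in 𝓝 (t₀, (0 : ℝ)),
      affCoord A (F z) = projMap (H.symm.trans A) (D.surface (σ z)) := by
    filter_upwards [hF, hH] with z hFz hHz using hFz.affCoord_eq_projMap hHz A
  have hdenom := hF.self_of_nhds.projMap_denom_ne_zero hH.self_of_nhds hA
  have hσ : fibreMobius r s p q (t₀, 0) = (t₀, 0) := σ.map_base
  rw [hσ] at hdenom
  refine ⟨⟨σ.symm, projDiffeoGerm hdenom ?_, ?_⟩⟩
  · rw [Function.comp_apply, hchart.self_of_nhds, σ.map_base]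
  · filter_upwards [σ.symm.tendsto.eventually hchart, σ.right_inv] with z hz hright
    exact ((congrArg (projMap _ ∘ D.surface) hright).symm.trans hz.symm)

end DevCurve

/-! ### The tangent developable -/

namespace DevCurve

variable {t₀ : ℝ} (D : DevCurve t₀)

theorem hasDerivAt_homog :
    ∀ᶠ t in 𝓝 t₀, HasDerivAt D.homog (deriv D.c₁ t • D.homogTangent t) t := by
  filter_upwards [D.smoothNear_curve.eventually, D.deriv_curve] with t hs hderiv
  have hcurve : HasDerivAt D.curve (deriv D.c₁ t • D.tangent t) t :=
    hderiv ▸ hs.differentiableAt.hasDerivAt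
  rw [hasDerivAt_pi] at hcurve ⊢
  refine Fin.cases ?_ hcurve
  simpa [homog, homogTangent] using hasDerivAt_const t (1 : ℝ)

theorem smoothNear_homog : SmoothNear D.homog t₀ := smoothNear_vecCons D.smoothNear_curve 1

theorem smoothNear_homogTangent : SmoothNear D.homogTangent t₀ :=
  smoothNear_vecCons D.smoothNear_tangent 0

theorem mem_tangentSpan_of_mem_span_pair {t m l : ℝ} (hm : m ≠ 0) {v w : V4}
    (hw : w = l • D.homog t + m • D.homogTangent t)
    (h : w ∈ Submodule.span ℝ {D.homog t, v}) : v ∈ D.tangentSpan t := by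
  obtain ⟨x, y, hxy⟩ := Submodule.mem_span_pair.1 h
  have hy : y ≠ 0 := by
    rintro rfl
    have h0 : l = x := by simpa [homog, homogTangent] using congrFun (hw.symm.trans hxy.symm) 0
    have h1 := congrFun (hw.symm.trans hxy.symm) 1
    simp [homog, homogTangent, curve, tangent, h0, hm] at h1
  rw [tangentSpan, Submodule.mem_span_pair]
  refine ⟨y⁻¹ * (l - x), y⁻¹ * m, ?_⟩
  apply smul_right_injective _ hy
  have : y • v = w - x • D.homog t := by rw [← hxy]; module
  simp only [this, hw, smul_add, smul_smul, mul_inv_cancel_left₀ hy]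
  module

theorem eventually_mem_tangentSpan_of_punctured {V : ℝ → V4} (hV : SmoothNear V t₀)
    (h : ∀ᶠ t in 𝓝[≠] t₀, V t ∈ D.tangentSpan t) : ∀ᶠ t in 𝓝 t₀, V t ∈ D.tangentSpan t := by
  simp only [mem_tangentSpan_iff] at h ⊢
  refine (hV.continuousAt.eventuallyEq_nhds_iff_eventuallyEq_nhdsNE ?_).1 h
  exact (((hV.apply 0).smul D.smoothNear_homog).add
    (((hV.apply 1).sub ((hV.apply 0).mul D.smooth_c₁)).smul
      D.smoothNear_homogTangent)).continuousAt

end DevCurve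

theorem TangentFrame.mem_tangentSpan {γ : ℝ → RP3} {t₀ : ℝ} {X W : ℝ → V4} {G : V4 ≃ₗ[ℝ] V4}
    {D : DevCurve t₀} {a b d : ℕ} (h : TangentFrame γ t₀ X W) (hD : D.HasOrders a b d)
    (h0 : G (X t₀) 0 ≠ 0) (hG : ∀ᶠ t in 𝓝 t₀, G (X t) = G (X t) 0 • D.homog t) :
    ∀ᶠ t in 𝓝 t₀, G (W t) ∈ D.tangentSpan t := by
  obtain ⟨⟨hX, -⟩, hW, hframe⟩ := h
  let x t := G (X t) 0
  have hx : SmoothNear x t₀ := (hX.linearMap_comp G.toLinearMap).apply 0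
  have hderiv : ∀ᶠ t in 𝓝 t₀, G (deriv X t) =
      deriv x t • D.homog t + (x t * deriv D.c₁ t) • D.homogTangent t := by
    filter_upwards [eventually_eventually_nhds.2 hG, hX.eventually, hx.eventually,
      D.hasDerivAt_homog] with t hGt hXt hxt hDt
    have hprod := (hxt.differentiableAt.hasDerivAt.smul hDt).congr_of_eventuallyEq hGt
    have hcomp := G.toLinearMap.toContinuousLinearMap.hasFDerivAt.comp_hasDerivAt t
      hXt.differentiableAt.hasDerivAt
    rw [mul_smul, add_comm]
    exact hcomp.unique hprod
  refine D.eventually_mem_tangentSpan_of_punctured (hW.linearMap_comp G.toLinearMap) ?_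
  filter_upwards [nhdsWithin_le_nhds (hframe.and (hderiv.and hG)),
    nhdsWithin_le_nhds (hx.continuousAt.eventually_ne h0),
    eventually_nhdsWithin_iff.2 hD.order_c₁.eventually_ne_zero]
    with t ⟨⟨_, hXW⟩, hderiv_t, hGt⟩ hxt hc₁
  refine D.mem_tangentSpan_of_mem_span_pair (mul_ne_zero hxt hc₁) hderiv_t ?_
  obtain ⟨y, z, hyz⟩ := Submodule.mem_span_pair.1 hXW
  refine Submodule.mem_span_pair.2 ⟨y * x t, z, ?_⟩
  rw [← hyz, map_add, map_smul, map_smul, hGt, smul_smul]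

theorem IsTangentDevelopable.exists_germEquiv {γ : ℝ → RP3} {t₀ : ℝ} {F : ℝ × ℝ → RP3}
    (hF : IsTangentDevelopable γ t₀ F) (hγ : FiniteType γ t₀) :
    ∃ (a b d : ℕ) (D : DevCurve t₀), HasType γ t₀ (a + 1) (a + b + 2) (a + b + d + 3) ∧
      D.HasOrders a b d ∧ ∀ A, InChart A (F (t₀, 0)) →
        Nonempty (GermEquiv D.surface (t₀, 0) (affCoord A ∘ F) (t₀, 0)) := by
  obtain ⟨X, W, hframe, hF⟩ := hF
  have hX := hframe.1
  obtain ⟨a, b, d, G, hG⟩ := hX.exists_isEchelon_typeIndices hγ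
  obtain ⟨h0, D, hD, -, hGX⟩ := hG.exists_devCurve hX.1
  refine ⟨a, b, d, D, hX.hasType hG, hD, fun A hA =>
    D.nonempty_germEquiv_of_ruled hX.1 hframe.2.1 hframe.2.2.self_of_nhds.1 ?_
      (hframe.mem_tangentSpan hD h0 hGX) ?_ hF hA⟩
  · filter_upwards [hGX] with t ht
    rw [ht]
    exact Submodule.smul_mem _ _ (Submodule.subset_span (by simp))
  · rw [hGX.self_of_nhds]
    exact Submodule.smul_mem _ _ (Submodule.mem_span_singleton_self _)

/-! ### Duality -/

/-- The inverse transpose of `G`, acting on dual homogeneous coordinates. -/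
def contragredient (G : V4 ≃ₗ[ℝ] V4) : V4 ≃ₗ[ℝ] V4 :=
  (dotProductEquiv ℝ (Fin 4)).trans (G.symm.dualMap.trans (dotProductEquiv ℝ (Fin 4)).symm)

theorem dotProduct_contragredient (G : V4 ≃ₗ[ℝ] V4) (v y : V4) :
    G v ⬝ᵥ contragredient G y = v ⬝ᵥ y := by
  have h : dotProductEquiv ℝ (Fin 4) (contragredient G y) (G v) = y ⬝ᵥ v := by
    simp [contragredient]
  simpa only [dotProductEquiv_apply_apply, dotProduct_comm] using h

/-- The change of dual homogeneous coordinates in which the curve of osculating planes of a curve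
in normal form is again in normal form. -/
def dualReversal : V4 ≃ₗ[ℝ] V4 where
  toFun y := ![y 3, -y 2, y 1, y 0]
  invFun z := ![z 3, z 2, -z 1, z 0]
  map_add' y z := by ext i; fin_cases i <;> simp [add_comm]
  map_smul' r y := by ext i; fin_cases i <;> simp
  left_inv y := by ext i; fin_cases i <;> simp
  right_inv z := by ext i; fin_cases i <;> simp

namespace DevCurve

variable {t₀ : ℝ} (D : DevCurve t₀)

/-- The curve of osculating planes, in the dual coordinates `dualReversal`. -/
def dual : DevCurve t₀ where
  c₁ := D.k
  c₂ t := D.k t * D.h₂ t - D.h₃ t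
  c₃ t := -(D.c₃ t - D.k t * D.c₂ t + (D.k t * D.h₂ t - D.h₃ t) * D.c₁ t)
  h₂ := D.h₂
  h₃ t := D.c₂ t - D.h₂ t * D.c₁ t
  k t := -D.c₁ t
  smooth_c₁ := D.smooth_k
  smooth_c₂ := (D.smooth_k.mul D.smooth_h₂).sub D.smooth_h₃
  smooth_c₃ := ((D.smooth_c₃.sub (D.smooth_k.mul D.smooth_c₂)).add
    (((D.smooth_k.mul D.smooth_h₂).sub D.smooth_h₃).mul D.smooth_c₁)).neg
  smooth_h₂ := D.smooth_h₂
  smooth_h₃ := D.smooth_c₂.sub (D.smooth_h₂.mul D.smooth_c₁)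
  smooth_k := D.smooth_c₁.neg
  deriv_c₂ := by
    filter_upwards [D.smooth_k.eventually, D.smooth_h₂.eventually, D.smooth_h₃.eventually,
      D.deriv_h₃] with t hk hh₂ hh₃ h₃
    rw [((hk.differentiableAt.hasDerivAt.fun_mul hh₂.differentiableAt.hasDerivAt).fun_sub
      hh₃.differentiableAt.hasDerivAt).deriv, h₃]
    ring
  deriv_c₃ := by
    filter_upwards [D.smooth_k.eventually, D.smooth_h₂.eventually, D.smooth_h₃.eventually,
      D.smooth_c₁.eventually, D.smooth_c₂.eventually, D.smooth_c₃.eventually,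
      D.deriv_h₃, D.deriv_c₂, D.deriv_c₃] with t hk hh₂ hh₃ hc₁ hc₂ hc₃ h₃ c₂ c₃
    have hk' := hk.differentiableAt.hasDerivAt
    rw [((hc₃.differentiableAt.hasDerivAt.fun_sub
      (hk'.fun_mul hc₂.differentiableAt.hasDerivAt)).fun_add
        (((hk'.fun_mul hh₂.differentiableAt.hasDerivAt).fun_sub
          hh₃.differentiableAt.hasDerivAt).fun_mul hc₁.differentiableAt.hasDerivAt)).fun_neg.deriv,
      h₃, c₂, c₃]
    ring
  deriv_h₃ := by
    filter_upwards [D.smooth_h₂.eventually, D.smooth_c₁.eventually, D.smooth_c₂.eventually,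
      D.deriv_c₂] with t hh₂ hc₁ hc₂ c₂
    rw [(hc₂.differentiableAt.hasDerivAt.fun_sub
      (hh₂.differentiableAt.hasDerivAt.fun_mul hc₁.differentiableAt.hasDerivAt)).deriv, c₂]
    ring

variable {D}

theorem HasOrders.dual {a b d : ℕ} (h : D.HasOrders a b d) : D.dual.HasOrders d b a :=
  ⟨h.order_k, h.order_h₂, h.order_c₁.neg.congr (.of_forall fun t => by simp [DevCurve.dual])⟩

theorem dualReversal_mem_tangentSpan_dual {t : ℝ} {η : V4} (hhomog : D.homog t ⬝ᵥ η = 0)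
    (htangent : D.homogTangent t ⬝ᵥ η = 0) : dualReversal η ∈ D.dual.tangentSpan t := by
  simp only [homog, homogTangent, curve, tangent, dotProduct, Fin.sum_univ_four,
    Matrix.cons_val] at hhomog htangent
  rw [mem_tangentSpan_iff]
  ext i
  fin_cases i <;>
    simp only [dualReversal, dual, homog, homogTangent, curve, tangent, LinearEquiv.coe_mk,
      LinearMap.coe_mk, AddHom.coe_mk, Pi.add_apply, Pi.smul_apply, smul_eq_mul, Fin.zero_eta,
      Fin.mk_one, Fin.reduceFinMk, Matrix.cons_val]
  · ring
  · ring
  · linear_combination htangent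
  · linear_combination hhomog - D.c₁ t * htangent

theorem dotProduct_eq_zero_of_linearIndependent {t : ℝ} {v w η : V4}
    (h : LinearIndependent ℝ ![v, w]) (hv : v ∈ Submodule.span ℝ {D.homog t})
    (hw : w ∈ D.tangentSpan t) (hvη : v ⬝ᵥ η = 0) (hwη : w ⬝ᵥ η = 0) :
    D.homog t ⬝ᵥ η = 0 ∧ D.homogTangent t ⬝ᵥ η = 0 := by
  obtain ⟨hv0, -, hw1⟩ := D.coeffs_of_linearIndependent h hv hw
  obtain ⟨x, rfl⟩ := Submodule.mem_span_singleton.1 hv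
  have hhomog : D.homog t ⬝ᵥ η = 0 := by
    rw [smul_dotProduct] at hvη
    exact (smul_eq_zero.1 hvη).resolve_left (left_ne_zero_of_mul hv0)
  rw [D.mem_tangentSpan_iff.1 hw, add_dotProduct, smul_dotProduct, smul_dotProduct, hhomog,
    smul_zero, zero_add] at hwη
  exact ⟨hhomog, (smul_eq_zero.1 hwη).resolve_left hw1⟩

theorem dualReversal_mem_span_homog_dual (hD : D.IsNormalized) {η : V4}
    (hη : ∀ i : Fin 4, i ≤ 2 → η i = 0) :
    dualReversal η ∈ Submodule.span ℝ {D.dual.homog t₀} := by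
  refine Submodule.mem_span_singleton.2 ⟨η 3, ?_⟩
  have hc := hD.curve_eq
  have hh := hD.tangent_eq
  have hk := hD.second_eq
  simp only [curve, tangent, second] at hc hh hk
  ext i
  fin_cases i <;> simp_all [dualReversal, homog, curve, dual]

end DevCurve

theorem IsEchelon.contragredient_apply_eq_zero {X : ℝ → V4} {t₀ : ℝ} {a b d : ℕ}
    {G : V4 ≃ₗ[ℝ] V4} (hG : IsEchelon (fun j => iteratedDeriv j X t₀) (typeIndices a b d) G)
    {y : V4} (hy : IsOsculatingPlane X t₀ y) {i : Fin 4} (hi : i ≤ 2) :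
    contragredient G y i = 0 := by
  obtain ⟨-, r, hrank, horth⟩ := hy
  have hcard := (hG.finrank_span (r + 1)).symm.trans hrank
  rw [card_typeIndices_lt] at hcard
  refine hG.eq_zero_of_dotProduct_eq_zero (r := r + 1) (fun j hj => ?_)
    ((hG.strictMono.monotone hi).trans_lt (b := typeIndices a b d 2) ?_)
  · rw [dotProduct_contragredient]
    exact horth j (Nat.lt_succ_iff.1 hj)
  · change a + b + 2 < r + 1
    split_ifs at hcard <;> omega

theorem TangentFrame.dualReversal_mem_tangentSpan {γ : ℝ → RP3} {t₀ : ℝ} {X W P : ℝ → V4}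
    {G : V4 ≃ₗ[ℝ] V4} {D : DevCurve t₀} {a b d : ℕ} (h : TangentFrame γ t₀ X W)
    (hD : D.HasOrders a b d) (h0 : G (X t₀) 0 ≠ 0)
    (hG : ∀ᶠ t in 𝓝 t₀, G (X t) = G (X t) 0 • D.homog t)
    (hP : ∀ᶠ t in 𝓝 t₀, X t ⬝ᵥ P t = 0 ∧ W t ⬝ᵥ P t = 0) :
    ∀ᶠ t in 𝓝 t₀, dualReversal (contragredient G (P t)) ∈ D.dual.tangentSpan t := by
  filter_upwards [h.2.2, h.mem_tangentSpan hD h0 hG, hG, hP] with t ⟨hXW, _⟩ hWt hGt ⟨hXP, hWP⟩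
  have hXt : G (X t) ∈ Submodule.span ℝ {D.homog t} :=
    Submodule.mem_span_singleton.2 ⟨_, hGt.symm⟩
  obtain ⟨hhomog, htangent⟩ := DevCurve.dotProduct_eq_zero_of_linearIndependent
    (linearIndependent_pair_map G hXW) hXt hWt ((dotProduct_contragredient G _ _).trans hXP)
    ((dotProduct_contragredient G _ _).trans hWP)
  exact DevCurve.dualReversal_mem_tangentSpan_dual hhomog htangent

theorem IsDualSurface.exists_germEquiv {γ : ℝ → RP3} {t₀ : ℝ} {F : ℝ × ℝ → RP3}
    (hF : IsDualSurface γ t₀ F) (hγ : FiniteType γ t₀) :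
    ∃ (a b d : ℕ) (D : DevCurve t₀), HasType γ t₀ (a + 1) (a + b + 2) (a + b + d + 3) ∧
      D.HasOrders d b a ∧ ∀ A, InChart A (F (t₀, 0)) →
        Nonempty (GermEquiv D.surface (t₀, 0) (affCoord A ∘ F) (t₀, 0)) := by
  obtain ⟨X, W, Y, Z, hframe, hY, hZ, hYZ, hosc, hF⟩ := hF
  have hX := hframe.1
  obtain ⟨a, b, d, G, hG⟩ := hX.exists_isEchelon_typeIndices hγ
  obtain ⟨h0, D, hD, hnorm, hGX⟩ := hG.exists_devCurve hX.1
  refine ⟨a, b, d, D.dual, hX.hasType hG, hD.dual, fun A hA =>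
    D.dual.nonempty_germEquiv_of_ruled (H := (contragredient G).trans dualReversal) hY hZ
      hYZ.self_of_nhds.1 ?_ ?_ ?_ hF hA⟩
  · exact hframe.dualReversal_mem_tangentSpan hD h0 hGX (hYZ.mono fun t h => ⟨h.2.1, h.2.2.1⟩)
  · exact hframe.dualReversal_mem_tangentSpan hD h0 hGX (hYZ.mono fun t h => h.2.2.2)
  · exact DevCurve.dualReversal_mem_span_homog_dual hnorm fun i hi =>
      hG.contragredient_apply_eq_zero hosc hi

/-! ### The models -/

/-- The curve whose developable is the model cuspidal edge. -/
def edgeCurve : DevCurve 0 where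
  c₁ t := 3 * t
  c₂ t := -3 * t ^ 2
  c₃ t := -t ^ 3
  h₂ t := -2 * t
  h₃ t := -t ^ 2
  k t := t
  smooth_c₁ := smoothNear_of_contDiff (by fun_prop) 0
  smooth_c₂ := smoothNear_of_contDiff (by fun_prop) 0
  smooth_c₃ := smoothNear_of_contDiff (by fun_prop) 0
  smooth_h₂ := smoothNear_of_contDiff (by fun_prop) 0
  smooth_h₃ := smoothNear_of_contDiff (by fun_prop) 0
  smooth_k := smoothNear_of_contDiff (by fun_prop) 0
  deriv_c₂ := .of_forall fun t => by simp; ring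
  deriv_c₃ := .of_forall fun t => by simp; ring
  deriv_h₃ := .of_forall fun t => by simp; ring

/-- The curve whose developable is the model swallowtail. -/
def tailCurve : DevCurve 0 where
  c₁ t := 6 * t ^ 2
  c₂ t := -8 * t ^ 3
  c₃ t := -3 * t ^ 4
  h₂ t := -2 * t
  h₃ t := -t ^ 2
  k t := t
  smooth_c₁ := smoothNear_of_contDiff (by fun_prop) 0
  smooth_c₂ := smoothNear_of_contDiff (by fun_prop) 0
  smooth_c₃ := smoothNear_of_contDiff (by fun_prop) 0
  smooth_h₂ := smoothNear_of_contDiff (by fun_prop) 0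
  smooth_h₃ := smoothNear_of_contDiff (by fun_prop) 0
  smooth_k := smoothNear_of_contDiff (by fun_prop) 0
  deriv_c₂ := .of_forall fun t => by simp; ring
  deriv_c₃ := .of_forall fun t => by simp; ring
  deriv_h₃ := .of_forall fun t => by simp; ring

theorem hasOrder_of_eq_mul_pow {f : ℝ → ℝ} {t₀ c : ℝ} (hc : c ≠ 0) (n : ℕ)
    (hf : ∀ t, f t = c * (t - t₀) ^ n) : HasOrder f t₀ n :=
  ⟨fun _ => c, smoothNear_const _ _, hc, .of_forall fun t => by rw [hf, mul_comm]⟩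

theorem edgeCurve_hasOrders : edgeCurve.HasOrders 0 0 0 where
  order_c₁ := hasOrder_of_eq_mul_pow (c := 3) (by norm_num) 0 fun t => by simp [edgeCurve]
  order_h₂ := hasOrder_of_eq_mul_pow (c := -2) (by norm_num) 0 fun t => by simp [edgeCurve]
  order_k := hasOrder_of_eq_mul_pow (c := 1) (by norm_num) 0 fun t => by simp [edgeCurve]

theorem tailCurve_hasOrders : tailCurve.HasOrders 1 0 0 where
  order_c₁ := hasOrder_of_eq_mul_pow (c := 12) (by norm_num) 1 fun t => by
    simp [tailCurve]; ring
  order_h₂ := hasOrder_of_eq_mul_pow (c := -2) (by norm_num) 0 fun t => by simp [tailCurve]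
  order_k := hasOrder_of_eq_mul_pow (c := 1) (by norm_num) 0 fun t => by simp [tailCurve]

/-- The right-left equivalence of a developable with the surface `f` obtained from it by the
change of parameters `(x, t) = (c₁ t + u, t)`. -/
def germEquivOfReparam (D : DevCurve 0) {f : ℝ × ℝ → E3} (h0 : D.c₁ 0 = 0)
    (hc : ContDiff ℝ ∞ D.c₁) (hf : ∀ t u, D.surface (t, u) = f (D.c₁ t + u, t)) :
    GermEquiv D.surface (0, 0) f (0, 0) where
  source :=
    { toFun := fun z => (D.c₁ z.1 + z.2, z.1)
      invFun := fun z => (z.2, z.1 - D.c₁ z.2)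
      smooth := smoothNear_of_contDiff (by fun_prop) _
      smooth_inv := smoothNear_of_contDiff (by fun_prop) _
      map_base := by simp [h0]
      inv_base := by simp [h0]
      left_inv := .of_forall fun z => by simp
      right_inv := .of_forall fun z => by simp }
  target :=
    { toFun := id
      invFun := id
      smooth := smoothNear_of_contDiff contDiff_id _
      smooth_inv := smoothNear_of_contDiff contDiff_id _
      map_base := by simp [hf, h0]
      inv_base := by simp [hf, h0]
      left_inv := .of_forall fun _ => rfl
      right_inv := .of_forall fun _ => rfl }
  comm := .of_forall fun z => hf z.1 z.2

theorem edgeCurve_surface (t u : ℝ) :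
    edgeCurve.surface (t, u) = cuspidalEdge (edgeCurve.c₁ t + u, t) := by
  ext i
  fin_cases i <;>
    simp [edgeCurve, DevCurve.surface, DevCurve.curve, DevCurve.tangent, cuspidalEdge] <;> ring

/-- The developable of `edgeCurve` as a parametrisation of the model cuspidal edge. -/
def edgeGermEquiv : GermEquiv edgeCurve.surface (0, 0) cuspidalEdge (0, 0) :=
  germEquivOfReparam _ (by simp [edgeCurve]) (by simp only [edgeCurve]; fun_prop) edgeCurve_surface

theorem tailCurve_surface (t u : ℝ) :
    tailCurve.surface (t, u) = swallowtail (tailCurve.c₁ t + u, t) := by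
  ext i
  fin_cases i <;>
    simp [tailCurve, DevCurve.surface, DevCurve.curve, DevCurve.tangent, swallowtail] <;> ring

/-- The developable of `tailCurve` as a parametrisation of the model swallowtail. -/
def tailGermEquiv : GermEquiv tailCurve.surface (0, 0) swallowtail (0, 0) :=
  germEquivOfReparam _ (by simp [tailCurve]) (by simp only [tailCurve]; fun_prop) tailCurve_surface

theorem IsTangentDevelopable.exists_hasType {γ γ' : ℝ → RP3} {t₀ t₀' : ℝ} {F F' : ℝ × ℝ → RP3}
    (hF : IsTangentDevelopable γ t₀ F) (hF' : IsTangentDevelopable γ' t₀' F')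
    (hγ : FiniteType γ t₀) (hγ' : FiniteType γ' t₀')
    (h : DiffeoGerms F (t₀, 0) F' (t₀', 0)) :
    ∃ a₁ a₂ a₃ : ℕ, HasType γ t₀ a₁ a₂ a₃ ∧ HasType γ' t₀' a₁ a₂ a₃ := by
  obtain ⟨A, B, hA, hB, he⟩ := h
  obtain ⟨a, b, d, D, htype, hD, hDF⟩ := hF.exists_germEquiv hγ
  obtain ⟨a', b', d', D', htype', hD', hDF'⟩ := hF'.exists_germEquiv hγ'
  obtain ⟨e⟩ := hDF A hA
  obtain ⟨e'⟩ := hDF' B hB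
  obtain ⟨eFF'⟩ := he.nonempty_germEquiv
  obtain ⟨rfl, rfl, rfl⟩ := ((e.trans eFF').trans
    (e'.symm D'.smoothNear_surface.continuousAt)).orders_eq hD hD'
  exact ⟨_, _, _, htype, htype'⟩

theorem IsDualSurface.hasType_of_diffeoToModel {γ : ℝ → RP3} {t₀ : ℝ} {F : ℝ × ℝ → RP3}
    {D : DevCurve 0} {a b d : ℕ} {f : ℝ × ℝ → E3} (hF : IsDualSurface γ t₀ F)
    (hγ : FiniteType γ t₀) (h : DiffeoToModel F (t₀, 0) f) (hD : D.HasOrders d b a)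
    (hDf : GermEquiv D.surface (0, 0) f (0, 0)) :
    HasType γ t₀ (a + 1) (a + b + 2) (a + b + d + 3) := by
  obtain ⟨A, hA, he⟩ := h
  obtain ⟨a', b', d', D', htype, hD', hDF⟩ := hF.exists_germEquiv hγ
  obtain ⟨e⟩ := hDF A hA
  obtain ⟨eFf⟩ := he.nonempty_germEquiv
  obtain ⟨rfl, rfl, rfl⟩ := ((e.trans eFf).trans
    (hDf.symm D.smoothNear_surface.continuousAt)).orders_eq hD' hD
  exact htype

end TangentDev

end

theorem mainTheorem9 :
    (∀ (γ γ' : ℝ → TangentDev.RP3) (t₀ t₀' : ℝ) (F F' : ℝ × ℝ → TangentDev.RP3),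
      TangentDev.SmoothCurveGerm γ t₀ → TangentDev.SmoothCurveGerm γ' t₀' →
      TangentDev.FiniteType γ t₀ → TangentDev.FiniteType γ' t₀' →
      TangentDev.IsTangentDevelopable γ t₀ F → TangentDev.IsTangentDevelopable γ' t₀' F' →
      TangentDev.DiffeoGerms F (t₀, 0) F' (t₀', 0) →
      ∃ a₁ a₂ a₃ : ℕ, TangentDev.HasType γ t₀ a₁ a₂ a₃ ∧ TangentDev.HasType γ' t₀' a₁ a₂ a₃) ∧
    (∀ (γ : ℝ → TangentDev.RP3) (t₀ : ℝ) (F : ℝ × ℝ → TangentDev.RP3),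
      TangentDev.SmoothCurveGerm γ t₀ → TangentDev.FiniteType γ t₀ →
      TangentDev.IsDualSurface γ t₀ F →
      (TangentDev.DiffeoToModel F (t₀, 0) TangentDev.cuspidalEdge →
        TangentDev.HasType γ t₀ 1 2 3) ∧
      (TangentDev.DiffeoToModel F (t₀, 0) TangentDev.swallowtail →
        TangentDev.HasType γ t₀ 1 2 4)) := by
  refine ⟨fun γ γ' t₀ t₀' F F' _ _ hγ hγ' hF hF' h => hF.exists_hasType hF' hγ hγ' h,
    fun γ t₀ F _ hγ hF => ⟨fun h => ?_, fun h => ?_⟩⟩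
  · exact hF.hasType_of_diffeoToModel (a := 0) (b := 0) (d := 0) hγ h
      TangentDev.edgeCurve_hasOrders TangentDev.edgeGermEquiv
  · exact hF.hasType_of_diffeoToModel (a := 0) (b := 0) (d := 1) hγ h
      TangentDev.tailCurve_hasOrders TangentDev.tailGermEquiv
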